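/- Let $\mathbb F$ be a field, $\ell,s,w\in\mathbb Z_{>0}$ and $(x_0,y_0)\in\mathbb F^2$. Write $\mathbb F[x,y]_\ell$ for the $\mathbb F[x]$-module of polynomials of $y$-degree at most $\ell$, and $\deg_w$ for the weighted degree with $\deg_w x^iy^j=i+wj$. Let $\le_w$ be the module monomial order that compares $\deg_w$ and breaks ties by the power of $x$ (the larger power of $x$ is larger). Gröbner bases of $\mathbb F[x]$-submodules of $\mathbb F[x,y]_\ell$ refer to $\le_w$, where $x^iy^j$ divides $x^{i'}y^{j'}$ iff $j=j'$ and $i\le i'$; a Gröbner basis is minimal if its elements are nonzero and no leading monomial divides that of another element. For $d=(d_x,d_y)$ let $Q^{[d_x,d_y]}(x_0,y_0)$ be the Hasse derivative, i.e. the coefficient of $x^{d_x}y^{d_y}$ in $Q(x+x_0,y+y_0)$; let $D_s=\{(d_x,d_y)\in\mathbb N_0^2: d_x+d_y<s\}$, ordered lexicographically, and let $M\subset\mathbb F[x,y]_\ell$ be the module of those $Q$ with $Q^{[d_x,d_y]}(x_0,y_0)=0$ for all $(d_x,d_y)\in D_s$. Let $\mathcal B=(b_1,\dots,b_{\ell+1})$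 be a minimal Gröbner basis of $\operatorname{Span}\mathcal B\subset\mathbb F[x,y]_\ell$, let $\delta_j=\deg_w b_j$, and let $e_j$ be the exponent of $y$ in the leading monomial of $b_j$. (For $\mathcal B=(1,y,\dots,y^\ell)$ one has $e_j=j-1$.) The algorithm InterpolatePoint receives $(x_0,y_0)$, $s$, the reduced basis $\hat{\mathcal B}=\mathcal B\bmod (x-x_0)^s$ (coefficients of the powers of $y$ reduced), and the $\delta_j$ and $e_j$. It computes the matrices $H_j=[\hat b_j^{[d_x,d_y]}(x_0,y_0)]_{(d_x,d_y)\in D_s}$, sets $T=I_{\ell+1}\in\mathbb F[x]^{(\ell+1)\times(\ell+1)}$, and for each $(d_x,d_y)\in D_s$, in order, performs this iteration. Let $v_j=H_j[d_x,d_y]$. If all $v_j$ are $0$, do nothing. Otherwise choose $t$ with $v_t\ne0$ and $\delta_t$ minimal, among equal $\delta_t$ the one with the largest $e_t$ (equivalently, with the $\le_w$-smallest leading monomial). Replace $H_j$ by $H_j-(v_j/v_t)H_t$ for $j\ne t$ and $H_t$ by its shift down by one row with first row zero, using the old $H_t$ throughout. Replace $T$ by $UT$, where $U$ is the identity matrix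 except for its $t$-th column, which has the entries $-v_j/v_t$ for $j\ne t$ and $x-x_0$ for $j=t$. Finally increase $\delta_t$ by one. The output is $T$ and the final degrees $\hat\delta_j$. Then InterpolatePoint is correct: $T\mathcal B$ is a (minimal) Gröbner basis of $\operatorname{Span}\mathcal B\cap M$, and $\hat\delta_j=\deg_w \hat b_j$ for each $\hat b_j\in T\mathcal B$; moreover, the leading monomial of $\hat b_j$ still has $y$-exponent $e_j$. In each iteration, $\deg_w$ of the chosen element $b_t$ of the current $T\mathcal B$ rises by exactly one, and $\deg_w$ of every other element is unchanged (in a skipped iteration no degree changes). The algorithm, with polynomials stored as coefficient arrays, the $H_j$ obtained from $\hat{\mathcal B}$ by Horner's rule, and $T$ updated by row operations, takes at most $K\ell^2s^3$ operations, i.e. $O(\ell^2s^3)$, with an absolute constant $K$. Here every arithmetic operation and zero test in $\mathbb F$ is counted, and every comparison of degrees (or of the $e_j$) and every increment of a degree as well. -/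

import Mathlib

open Polynomial
open scoped Polynomial.Bivariate

namespace KNH

/-! ## Bivariate polynomials, weighted degrees, Gröbner bases

`F[X][Y]` is the ring of bivariate polynomials, as polynomials in `y` over `F[x]`; the coefficient
of `x ^ i * y ^ j` in `Q` is `(Q.coeff j).coeff i`. A monomial `x ^ i * y ^ j` is the pair `(i, j)`. -/

section Algebra

variable {F : Type*} [Field F]

/-- The monomials that occur in `Q`. -/
def monomials (Q : F[X][Y]) : Set (ℕ × ℕ) := {m | (Q.coeff m.2).coeff m.1 ≠ 0}

/-- The `(1, w)`-weighted degree of a monomial. -/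
def monDeg (w : ℕ) (m : ℕ × ℕ) : ℕ := m.1 + w * m.2

/-- The weighted degree of `Q`: the maximum of the weighted degrees of its monomials,
and `⊥` for `Q = 0`. -/
noncomputable def wdeg (w : ℕ) (Q : F[X][Y]) : WithBot ℕ :=
  Q.support.sup fun j => (Q.coeff j).support.sup fun i => ((monDeg w (i, j) : ℕ) : WithBot ℕ)

/-- The module monomial order `≤_w`: compare weighted degrees, and break ties by the power
of `x`. -/
def monLE (w : ℕ) (m m' : ℕ × ℕ) : Prop :=
  monDeg w m < monDeg w m' ∨ (monDeg w m = monDeg w m' ∧ m.1 ≤ m'.1)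

/-- `m` is the leading monomial of `Q` with respect to `≤_w`. -/
def IsLeadMon (w : ℕ) (Q : F[X][Y]) (m : ℕ × ℕ) : Prop :=
  m ∈ monomials Q ∧ ∀ m' ∈ monomials Q, monLE w m' m

/-- Divisibility of module monomials over `F[x]`: same power of `y`, smaller power of `x`. -/
def MonDvd (m m' : ℕ × ℕ) : Prop := m.2 = m'.2 ∧ m.1 ≤ m'.1

/-- The family `b` is a Gröbner basis of the `F[x]`-module `N` with respect to `≤_w`. -/
def IsGroebnerBasis {ι : Type*} (w : ℕ) (b : ι → F[X][Y]) (N : Submodule F[X] F[X][Y]) : Prop :=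
  (∀ j, b j ∈ N) ∧
    ∀ f ∈ N, f ≠ 0 → ∃ j m m', IsLeadMon w (b j) m ∧ IsLeadMon w f m' ∧ MonDvd m m'

/-- A minimal Gröbner basis: no element is zero, and the leading monomial of no element is
divisible by that of another element. -/
def IsMinGroebnerBasis {ι : Type*} (w : ℕ) (b : ι → F[X][Y])
    (N : Submodule F[X] F[X][Y]) : Prop :=
  IsGroebnerBasis w b N ∧ (∀ j, b j ≠ 0) ∧
    ∀ j k m m', j ≠ k → IsLeadMon w (b j) m → IsLeadMon w (b k) m' → ¬ MonDvd m m'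

/-- The translate `Q (x + x₀, y + y₀)`. -/
noncomputable def translate (x₀ y₀ : F) (Q : F[X][Y]) : F[X][Y] :=
  (Q.map (compRingHom (X + C x₀))).comp (X + C (C y₀))

/-- The `(dx, dy)` Hasse derivative of `Q` at `(x₀, y₀)`. -/
noncomputable def hasse (x₀ y₀ : F) (dx dy : ℕ) (Q : F[X][Y]) : F :=
  ((translate x₀ y₀ Q).coeff dy).coeff dx

/-- `Q` has a zero of multiplicity at least `s` at `(x₀, y₀)`. -/
def HasZero (s : ℕ) (x₀ y₀ : F) (Q : F[X][Y]) : Prop :=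
  ∀ dx dy : ℕ, dx + dy < s → hasse x₀ y₀ dx dy Q = 0

/-- Reduction of every coefficient `Q_j` of `Q = ∑ Q_j y ^ j` modulo `p`. -/
noncomputable def modX (Q : F[X][Y]) (p : F[X]) : F[X][Y] :=
  ∑ j ∈ Q.support, monomial j (Q.coeff j % p)

/-- The product of a matrix over `F[x]` and a (column) family of polynomials. -/
noncomputable def matApply {n : ℕ} (T : Matrix (Fin n) (Fin n) F[X]) (b : Fin n → F[X][Y]) :
    Fin n → F[X][Y] :=
  fun j => ∑ k, T j k • b k

lemma translate_add (x₀ y₀ : F) (P Q : F[X][Y]) :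
    translate x₀ y₀ (P + Q) = translate x₀ y₀ P + translate x₀ y₀ Q := by
  simp [translate]

lemma translate_smul (x₀ y₀ : F) (p : F[X]) (Q : F[X][Y]) :
    translate x₀ y₀ (p • Q) = p.comp (X + C x₀) • translate x₀ y₀ Q := by
  simp [translate, smul_eq_C_mul]

/-- The `F[x]`-module of the polynomials of `y`-degree at most `ℓ` that have a zero of multiplicity
at least `s` at `(x₀, y₀)`. -/
noncomputable def zeroModule (ℓ s : ℕ) (x₀ y₀ : F) : Submodule F[X] F[X][Y] where
  carrier := {Q | Q ∈ degreeLE F[X] (ℓ : WithBot ℕ) ∧ HasZero s x₀ y₀ Q}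
  add_mem' := by
    rintro P Q ⟨hP, hP'⟩ ⟨hQ, hQ'⟩
    refine ⟨Submodule.add_mem _ hP hQ, fun dx dy h => ?_⟩
    have h1 := hP' dx dy h
    have h2 := hQ' dx dy h
    simp only [hasse] at h1 h2 ⊢
    rw [translate_add, coeff_add, coeff_add, h1, h2, add_zero]
  zero_mem' := ⟨Submodule.zero_mem _, fun dx dy _ => by simp [hasse, translate]⟩
  smul_mem' := by
    rintro p Q ⟨hQ, hQ'⟩
    refine ⟨Submodule.smul_mem _ p hQ, fun dx dy h => ?_⟩
    simp only [hasse]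
    rw [translate_smul, coeff_smul, smul_eq_mul, coeff_mul]
    refine Finset.sum_eq_zero fun a ha => ?_
    have h1 : a.1 + a.2 = dx := Finset.HasAntidiagonal.mem_antidiagonal.mp ha
    have h2 := hQ' a.2 dy (by omega)
    simp only [hasse] at h2
    rw [h2, mul_zero]

end Algebra

/-! ## The algorithm InterpolatePoint -/

section Algorithm

/-- The list of the `(dx, dy)` with `dx + dy < s`, in lexicographic order. -/
def orders (s : ℕ) : List (Fin s × Fin s) :=
  ((List.finRange s).product (List.finRange s)).filter fun d => (d.1 : ℕ) + (d.2 : ℕ) < s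

variable {F : Type*} [Field F] [DecidableEq F]

/-- The data of the loop: the matrices `H_j` (row index `dx`, column index `dy`), the matrix `T`
and the weighted degrees `δ_j`. -/
structure LoopState (F : Type*) [Field F] (ℓ s : ℕ) where
  H : Fin (ℓ + 1) → Matrix (Fin s) (Fin s) F
  T : Matrix (Fin (ℓ + 1)) (Fin (ℓ + 1)) F[X]
  δ : Fin (ℓ + 1) → ℕ

/-- The index `t` with `v t ≠ 0` for which `δ t` is minimal, where among equal `δ` the one
with the largest `e` is taken; `none` if `v = 0`. Here `e j` is the power of `y` in the leading
monomial of the `j`-th basis element: among leading monomials of equal weighted degree, the one with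
the largest power of `y` has the smallest power of `x`, so it is the smallest for `≤_w`. -/
def pivot {ℓ : ℕ} (e δ : Fin (ℓ + 1) → ℕ) (v : Fin (ℓ + 1) → F) : Option (Fin (ℓ + 1)) :=
  ((List.finRange (ℓ + 1)).filter fun j => v j ≠ 0).argmin
    fun j => toLex (δ j, OrderDual.toDual (e j))

/-- The pivot in the iteration for `(dx, dy) = d`. -/
def LoopState.pivot {ℓ s : ℕ} (e : Fin (ℓ + 1) → ℕ) (σ : LoopState F ℓ s)
    (d : Fin s × Fin s) : Option (Fin (ℓ + 1)) :=
  KNH.pivot e σ.δ fun j => σ.H j d.1 d.2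

/-- The matrix shifted down by one row, with first row zero. -/
def shiftDown {R : Type*} (z : R) {s : ℕ} (H : Fin s → Fin s → R) : Fin s → Fin s → R :=
  fun a b => if a.val = 0 then z else H ⟨a.val - 1, by omega⟩ b

/-- The update matrix `U`: the identity matrix minus the matrix that is zero outside of column
`t` and has `v j / v t` at the places `j ≠ t` and `1 - (x - x₀)` at the place `t` of this column. -/
noncomputable def updateMatrix {ℓ : ℕ} (x₀ : F) (t : Fin (ℓ + 1)) (v : Fin (ℓ + 1) → F) :
    Matrix (Fin (ℓ + 1)) (Fin (ℓ + 1)) F[X] :=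
  1 - Matrix.of fun j k =>
    if k = t then (if j = t then 1 - (X - C x₀) else C (v j / v t)) else 0

/-- The state before the loop; `bhat` is the reduced basis. -/
noncomputable def initState {ℓ : ℕ} (s : ℕ) (x₀ y₀ : F) (bhat : Fin (ℓ + 1) → F[X][Y])
    (δ : Fin (ℓ + 1) → ℕ) : LoopState F ℓ s where
  H := fun j => Matrix.of fun a b =>
    if (a : ℕ) + (b : ℕ) < s then hasse x₀ y₀ a b (bhat j) else 0
  T := 1
  δ := δ

/-- One iteration of the loop; nothing happens if there is no pivot. -/
noncomputable def LoopState.step {ℓ s : ℕ} (x₀ : F) (e : Fin (ℓ + 1) → ℕ) (σ : LoopState F ℓ s)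
    (d : Fin s × Fin s) : LoopState F ℓ s :=
  match σ.pivot e d with
  | none => σ
  | some t =>
    { H := fun j =>
        if j = t then Matrix.of (shiftDown 0 (σ.H t))
        else σ.H j - (σ.H j d.1 d.2 / σ.H t d.1 d.2) • σ.H t
      T := updateMatrix x₀ t (fun j => σ.H j d.1 d.2) * σ.T
      δ := Function.update σ.δ t (σ.δ t + 1) }

/-- The state after the iterations for the members of the list `ds`. -/
noncomputable def loop {ℓ : ℕ} (s : ℕ) (x₀ y₀ : F) (bhat : Fin (ℓ + 1) → F[X][Y])
    (δ e : Fin (ℓ + 1) → ℕ) (ds : List (Fin s × Fin s)) : LoopState F ℓ s :=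
  ds.foldl (fun σ d => σ.step x₀ e d) (initState s x₀ y₀ bhat δ)

/-- The algorithm InterpolatePoint: it returns `T` and the updated degrees. -/
noncomputable def interpolatePoint {ℓ : ℕ} (s : ℕ) (x₀ y₀ : F) (bhat : Fin (ℓ + 1) → F[X][Y])
    (δ e : Fin (ℓ + 1) → ℕ) : Matrix (Fin (ℓ + 1)) (Fin (ℓ + 1)) F[X] × (Fin (ℓ + 1) → ℕ) :=
  ((loop s x₀ y₀ bhat δ e (orders s)).T, (loop s x₀ y₀ bhat δ e (orders s)).δ)

end Algorithm

/-! ## Programs over a field and their cost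

A `FieldProg R α` is a program that returns an element of `α` and has no access to the
elements of `R` other than by the instructions below. The programs are written for a bare type `R`
without any structure; only `eval` and `cost` interpret `R` as a field. -/

section Program

/-- The binary field operations. -/
inductive FieldOp
  | add | sub | mul | div

/-- Programs over the registers `R`: return a value; fetch the constants `0` and `1`; apply a field
operation; test an element for zero; compare two degrees; increase a degree by one. -/
inductive FieldProg (R : Type*) (α : Type*)
  | ret (a : α)
  | zero (k : R → FieldProg R α)
  | one (k : R → FieldProg R α)
  | arith (o : FieldOp) (x y : R) (k : R → FieldProg R α)
  | isZero (x : R) (k : Bool → FieldProg R α)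
  | lt (m n : ℕ) (k : Bool → FieldProg R α)
  | succ (n : ℕ) (k : ℕ → FieldProg R α)

/-- The meaning of the field operations. -/
def FieldOp.eval {F : Type*} [Field F] : FieldOp → F → F → F
  | .add, x, y => x + y
  | .sub, x, y => x - y
  | .mul, x, y => x * y
  | .div, x, y => x / y

namespace FieldProg

/-- The value that the program returns over the field `F`. -/
def eval {F α : Type*} [Field F] [DecidableEq F] : FieldProg F α → α
  | ret a => a
  | zero k => (k 0).eval
  | one k => (k 1).eval
  | arith o x y k => (k (o.eval x y)).eval
  | isZero x k => (k (decide (x = 0))).eval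
  | lt m n k => (k (decide (m < n))).eval
  | succ n k => (k (n + 1)).eval

/-- The number of instructions that the program executes over the field `F`. -/
def cost {F α : Type*} [Field F] [DecidableEq F] : FieldProg F α → ℕ
  | ret _ => 0
  | zero k => (k 0).cost + 1
  | one k => (k 1).cost + 1
  | arith o x y k => (k (o.eval x y)).cost + 1
  | isZero x k => (k (decide (x = 0))).cost + 1
  | lt m n k => (k (decide (m < n))).cost + 1
  | succ n k => (k (n + 1)).cost + 1

variable {R α β : Type*}

/-- Sequential composition. -/
def bind : FieldProg R α → (α → FieldProg R β) → FieldProg R β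
  | ret a, f => f a
  | zero k, f => zero fun x => (k x).bind f
  | one k, f => one fun x => (k x).bind f
  | arith o x y k, f => arith o x y fun z => (k z).bind f
  | isZero x k, f => isZero x fun c => (k c).bind f
  | lt m n k, f => lt m n fun c => (k c).bind f
  | succ n k, f => succ n fun m => (k m).bind f

/-- Run `f 0, …, f (n - 1)` one after the other and collect the results. -/
def tab : (n : ℕ) → (Fin n → FieldProg R α) → FieldProg R (Fin n → α)
  | 0, _ => ret Fin.elim0
  | n + 1, f =>
    (f 0).bind fun a => (tab n fun i => f i.succ).bind fun g => ret (Fin.cons a g)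

/-- Run the body `f` for the members of a list, passing on a state. -/
def fold (f : β → α → FieldProg R β) : β → List α → FieldProg R β
  | b, [] => ret b
  | b, a :: as => (f b a).bind fun b' => fold f b' as

end FieldProg

open FieldProg

variable {R : Type*}

/-- The first `s` coefficients of `p (x + x₀)` from the coefficients `c` of `p`, by Horner's rule
`p (x + x₀) = c 0 + (x + x₀) * p' (x + x₀)` for `p = c 0 + x * p'`; `z` holds the zero. -/
def taylorProg (s : ℕ) (z x₀ : R) : (n : ℕ) → (Fin n → R) → FieldProg R (Fin s → R)
  | 0, _ => ret fun _ => z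
  | n + 1, c =>
    (taylorProg s z x₀ n fun i => c i.succ).bind fun a => tab s fun d =>
      arith .mul x₀ (a d) fun m =>
        arith .add m (if d.val = 0 then c 0 else a ⟨d.val - 1, by omega⟩) fun r => ret r

/-- The matrix of the Hasse derivatives at `(x₀, y₀)` of order in `orders s` (and zero at the other
places) of the polynomial with the coefficient `c k i` at `x ^ i * y ^ k`. -/
def hasseProg {ℓ s : ℕ} (z x₀ y₀ : R) (c : Fin (ℓ + 1) → Fin s → R) :
    FieldProg R (Fin s → Fin s → R) :=
  (tab (ℓ + 1) fun k => taylorProg s z x₀ s (c k)).bind fun cx =>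
    (tab s fun a => taylorProg s z y₀ (ℓ + 1) fun k => cx k a).bind fun h =>
      ret fun a b => if (a : ℕ) + (b : ℕ) < s then h a b else z

/-- The data of the loop, with the entries of `T` (polynomials of degree at most `s`) stored by
their coefficients. -/
structure ProgState (R : Type*) (ℓ s : ℕ) where
  H : Fin (ℓ + 1) → Fin s → Fin s → R
  T : Fin (ℓ + 1) → Fin (ℓ + 1) → Fin (s + 1) → R
  δ : Fin (ℓ + 1) → ℕ

/-- Decide whether `j` is to be preferred to `i` as pivot. -/
def betterProg {ℓ : ℕ} (e δ : Fin (ℓ + 1) → ℕ) (j i : Fin (ℓ + 1)) : FieldProg R Bool :=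
  lt (δ j) (δ i) fun c =>
    if c then ret true
    else lt (δ i) (δ j) fun c' => if c' then ret false else lt (e i) (e j) fun c'' => ret c''

/-- Find the pivot by a linear search. -/
def pivotProg {ℓ : ℕ} (e δ : Fin (ℓ + 1) → ℕ) (v : Fin (ℓ + 1) → R) :
    FieldProg R (Option (Fin (ℓ + 1))) :=
  fold (fun best j => isZero (v j) fun c =>
    if c then ret best
    else match best with
      | none => ret (some j)
      | some i => (betterProg e δ j i).bind fun c' => ret (if c' then some j else some i))
    none (List.finRange (ℓ + 1))

/-- `g - q * h`, entry by entry. -/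
def subMulProg {n : ℕ} (q : R) (g h : Fin n → R) : FieldProg R (Fin n → R) :=
  tab n fun i => arith .mul q (h i) fun m => arith .sub (g i) m fun r => ret r

/-- The coefficients of `(x - x₀) * p`, for a polynomial `p` of degree less than `n - 1`. -/
def mulLinProg {n : ℕ} (z x₀ : R) (p : Fin n → R) : FieldProg R (Fin n → R) :=
  tab n fun i => arith .mul x₀ (p i) fun m =>
    arith .sub (if i.val = 0 then z else p ⟨i.val - 1, by omega⟩) m fun r => ret r

/-- One iteration of the loop. -/
def stepProg {ℓ s : ℕ} (z x₀ : R) (e : Fin (ℓ + 1) → ℕ) (σ : ProgState R ℓ s)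
    (d : Fin s × Fin s) : FieldProg R (ProgState R ℓ s) :=
  (pivotProg e σ.δ fun j => σ.H j d.1 d.2).bind fun p =>
    match p with
    | none => ret σ
    | some t =>
      (tab (ℓ + 1) fun j =>
        arith .div (σ.H j d.1 d.2) (σ.H t d.1 d.2) fun r => ret r).bind fun q =>
      (tab (ℓ + 1) fun j =>
        if j = t then ret (shiftDown z (σ.H t))
        else tab s fun a => subMulProg (q j) (σ.H j a) (σ.H t a)).bind fun H' =>
      (tab (ℓ + 1) fun j => tab (ℓ + 1) fun k =>
        if j = t then mulLinProg z x₀ (σ.T t k)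
        else subMulProg (q j) (σ.T j k) (σ.T t k)).bind fun T' =>
      succ (σ.δ t) fun m => ret ⟨H', T', Function.update σ.δ t m⟩

/-- InterpolatePoint as a program. The input `c j k i` is the coefficient of `x ^ i * y ^ k` in the
`j`-th element of the reduced basis. -/
def interpolatePointProg {ℓ s : ℕ} (x₀ y₀ : R) (c : Fin (ℓ + 1) → Fin (ℓ + 1) → Fin s → R)
    (δ e : Fin (ℓ + 1) → ℕ) :
    FieldProg R ((Fin (ℓ + 1) → Fin (ℓ + 1) → Fin (s + 1) → R) × (Fin (ℓ + 1) → ℕ)) :=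
  zero fun z => one fun u =>
    (tab (ℓ + 1) fun j => hasseProg z x₀ y₀ (c j)).bind fun H =>
      (fold (fun σ d => stepProg z x₀ e σ d)
        ⟨H, fun j k i => if j = k ∧ i.val = 0 then u else z, δ⟩ (orders s)).bind fun σ =>
          ret (σ.T, σ.δ)

end Program

end KNH

/-! Correctness. Every iteration cuts the current module `N` down to the kernel of one map `D`, the
Hasse derivative of the current order `(dx, dy)`. The orders come lexicographically, so on `N` the
derivatives `(a, dy)` with `a < dx` already vanish, and the Leibniz rule leaves `D (p • f) = p(x₀) *
D f` (`hasse_smul_of_forall_lt`). Hence the kernel is again a module. The pivot `b_t` has the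
smallest leading monomial among the basis elements with `D b_j ≠ 0`. Subtracting a multiple of it
therefore does not change any other leading monomial, and multiplication by `x - x₀` raises the
exponent of `x` in its own by one.

The new family is a Gröbner basis of the kernel unless some `f` in the kernel has exactly the
leading monomial of `b_t`. In that case `f - c * b_t` with `c ≠ 0` lies below this monomial, and
dividing it by the basis only involves elements with `D b_j = 0`. So `D` vanishes on `f - c * b_t`
and thus on `b_t`, a contradiction. This is `IsMinGroebnerBasis.updateBasis`; `LoopInvariant.step`
carries it through the loop. The matrices `H_j` may start from the reduced basis because `(x - x₀) ^
s` does not affect derivatives of `x`-order below `s`.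

Cost. There are at most `s ^ 2` iterations, and an update of all `H_j` costs about `ℓ * s ^ 2`,
which would only give `ℓ * s ^ 4` for the `H_j`. But an element is pivot at most once for each `dx`:
after multiplication by `x - x₀` its row `dx` is its old row `dx - 1`, where all relevant entries
are zero. So there are at most `(ℓ + 1) * s` updates, and the entries of `T` have degree at most `s`
(`LoopInvariant.growth`). Since `∑ δ_j` rises by one at each pivot, it serves as the potential in
`cost_stepProg_le`. Updating `T` costs about `ℓ ^ 2 * s` and may be charged to every iteration. -/

namespace KNH

/-! ### Hasse derivatives under module operations and reduction modulo `(x - x₀) ^ s` -/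

section Hasse

variable {F : Type*} [Field F] (x₀ y₀ : F)

lemma translate_sub (P Q : F[X][Y]) :
    translate x₀ y₀ (P - Q) = translate x₀ y₀ P - translate x₀ y₀ Q := by
  simp [translate]

lemma hasse_add (a c : ℕ) (P Q : F[X][Y]) :
    hasse x₀ y₀ a c (P + Q) = hasse x₀ y₀ a c P + hasse x₀ y₀ a c Q := by
  simp [hasse, translate_add]

lemma hasse_sub (a c : ℕ) (P Q : F[X][Y]) :
    hasse x₀ y₀ a c (P - Q) = hasse x₀ y₀ a c P - hasse x₀ y₀ a c Q := by
  simp [hasse, translate_sub]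

@[simp] lemma hasse_zero (a c : ℕ) : hasse x₀ y₀ a c 0 = 0 := by
  simp [hasse, translate]

lemma hasse_C_smul (a c : ℕ) (r : F) (Q : F[X][Y]) :
    hasse x₀ y₀ a c ((C r : F[X]) • Q) = r * hasse x₀ y₀ a c Q := by
  simp [hasse, translate_smul]

lemma hasse_X_sub_C_smul (a c : ℕ) (Q : F[X][Y]) :
    hasse x₀ y₀ a c ((X - C x₀) • Q) = if a = 0 then 0 else hasse x₀ y₀ (a - 1) c Q := by
  have h : (X - C x₀ : F[X]).comp (X + C x₀) = X := by simp
  rw [hasse, translate_smul, h, coeff_smul, smul_eq_mul]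
  cases a <;> simp [hasse]

/-- The translation turns `(x - x₀) ^ s` into `x ^ s`, and multiples of `x ^ s` have no coefficients
below `s`. -/
lemma hasse_X_sub_C_pow_smul {a s : ℕ} (h : a < s) (c : ℕ) (Q : F[X][Y]) :
    hasse x₀ y₀ a c (((X - C x₀) ^ s) • Q) = 0 := by
  have h' : ((X - C x₀ : F[X]) ^ s).comp (X + C x₀) = X ^ s := by simp
  rw [hasse, translate_smul, h', coeff_smul, smul_eq_mul, coeff_X_pow_mul', if_neg (by omega)]

/-- The Hasse derivative of a multiple of a polynomial for which the Hasse derivatives of lower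
order in `x` vanish. -/
lemma hasse_smul_of_forall_lt {a c : ℕ} {Q : F[X][Y]} (h : ∀ a' < a, hasse x₀ y₀ a' c Q = 0)
    (p : F[X]) : hasse x₀ y₀ a c (p • Q) = p.eval x₀ * hasse x₀ y₀ a c Q := by
  rw [hasse, translate_smul, coeff_smul, smul_eq_mul, coeff_mul,
    Finset.sum_eq_single_of_mem (0, a) (by simp)]
  · simp [hasse, coeff_zero_eq_eval_zero, eval_comp]
  · rintro ⟨i, k⟩ hik hne
    have h1 : i + k = a := by simpa using hik
    have h2 : k < a := by
      rcases Nat.eq_zero_or_pos i with rfl | hi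
      · exact absurd (by simpa using h1) (fun h' => hne (by simp [h']))
      · omega
    have := h k h2
    simp only [hasse] at this
    simp [this]

lemma eq_modX_add (Q : F[X][Y]) (p : F[X]) :
    Q = modX Q p + p • ∑ j ∈ Q.support, monomial j (Q.coeff j / p) := by
  rw [modX, Finset.smul_sum, ← Finset.sum_add_distrib]
  conv_lhs => rw [Q.as_sum_support]
  refine Finset.sum_congr rfl fun j _ => ?_
  rw [smul_monomial, ← map_add, smul_eq_mul, EuclideanDomain.mod_add_div]

lemma hasse_modX {a s : ℕ} (h : a < s) (c : ℕ) (Q : F[X][Y]) :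
    hasse x₀ y₀ a c (modX Q ((X - C x₀) ^ s)) = hasse x₀ y₀ a c Q := by
  conv_rhs => rw [eq_modX_add Q ((X - C x₀) ^ s), hasse_add, hasse_X_sub_C_pow_smul x₀ y₀ h, add_zero]

lemma coeff_modX (Q : F[X][Y]) (p : F[X]) (j : ℕ) : (modX Q p).coeff j = Q.coeff j % p := by
  rw [modX, finsetSum_coeff]
  simp only [coeff_monomial]
  rw [Finset.sum_ite_eq']
  split_ifs with h
  · rfl
  · rw [notMem_support_iff.1 h, EuclideanDomain.zero_mod]

end Hasse

/-! ### The order `≤_w` and leading monomials -/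

section LeadingMonomials

variable {F : Type*} [Field F] {w : ℕ}

/-- The position of a monomial in the order `≤_w`. -/
def monKey (w : ℕ) (m : ℕ × ℕ) : ℕ ×ₗ ℕ := toLex (monDeg w m, m.1)

lemma monLE_iff {m m' : ℕ × ℕ} : monLE w m m' ↔ monKey w m ≤ monKey w m' := by
  simp [monLE, monKey, Prod.Lex.le_iff]

lemma monKey_lt_iff {m m' : ℕ × ℕ} : monKey w m < monKey w m' ↔
    monDeg w m < monDeg w m' ∨ (monDeg w m = monDeg w m' ∧ m.1 < m'.1) := by
  simp [monKey, Prod.Lex.lt_iff]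

/-- Weighted degree and exponent of `x` determine `w * j`, hence `j` because `w` is positive.
Uniqueness of leading monomials rests on this. -/
lemma monKey_injective (hw : 0 < w) : Function.Injective (monKey w) := by
  rintro ⟨i, j⟩ ⟨i', j'⟩ h
  have h' : i + w * j = i' + w * j' ∧ i = i' := by
    simpa [monKey, monDeg] using h
  obtain ⟨h1, rfl⟩ := h'
  have h2 : w * j = w * j' := by omega
  rw [Nat.eq_of_mul_eq_mul_left hw h2]

lemma monKey_add_lt_iff {i j i' j' a : ℕ} :
    monKey w (i + a, j) < monKey w (i' + a, j') ↔ monKey w (i, j) < monKey w (i', j') := by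
  simp only [monKey_lt_iff, monDeg]
  omega

lemma monKey_le_add (i j a : ℕ) : monKey w (i, j) ≤ monKey w (i + a, j) := by
  rw [← monLE_iff]
  simp only [monLE, monDeg]
  omega

lemma finite_monomials (Q : F[X][Y]) : (monomials Q).Finite := by
  refine (Q.support.biUnion fun j => (Q.coeff j).support.image fun i => (i, j)).finite_toSet.subset ?_
  rintro ⟨i, j⟩ h
  have h : (Q.coeff j).coeff i ≠ 0 := h
  have h' : Q.coeff j ≠ 0 := fun h0 => h (by simp [h0])
  simp [h, h']

lemma monomials_nonempty {Q : F[X][Y]} (hQ : Q ≠ 0) : (monomials Q).Nonempty := by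
  obtain ⟨j, hj⟩ := nonempty_support_iff.2 hQ
  obtain ⟨i, hi⟩ := nonempty_support_iff.2 (mem_support_iff.1 hj)
  exact ⟨(i, j), mem_support_iff.1 hi⟩

lemma exists_isLeadMon (w : ℕ) {Q : F[X][Y]} (hQ : Q ≠ 0) : ∃ m, IsLeadMon w Q m := by
  obtain ⟨m, hm, h⟩ := Set.exists_max_image _ (monKey w) (finite_monomials Q) (monomials_nonempty hQ)
  exact ⟨m, hm, fun m' hm' => monLE_iff.2 (h m' hm')⟩

lemma IsLeadMon.ne_zero {Q : F[X][Y]} {m : ℕ × ℕ} (h : IsLeadMon w Q m) : Q ≠ 0 := by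
  rintro rfl
  exact h.1 (by simp)

lemma IsLeadMon.eq (hw : 0 < w) {Q : F[X][Y]} {m m' : ℕ × ℕ} (h : IsLeadMon w Q m)
    (h' : IsLeadMon w Q m') : m = m' :=
  monKey_injective hw (le_antisymm (monLE_iff.1 (h'.2 m h.1)) (monLE_iff.1 (h.2 m' h'.1)))

lemma IsLeadMon.coeff_eq_zero {Q : F[X][Y]} {m : ℕ × ℕ} (h : IsLeadMon w Q m) {i j : ℕ}
    (hij : monKey w m < monKey w (i, j)) : (Q.coeff j).coeff i = 0 := by
  by_contra h0
  exact absurd (monLE_iff.1 (h.2 (i, j) h0)) (not_le.2 hij)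

lemma IsLeadMon.wdeg_eq {Q : F[X][Y]} {m : ℕ × ℕ} (h : IsLeadMon w Q m) :
    wdeg w Q = (monDeg w m : WithBot ℕ) := by
  apply le_antisymm
  · refine Finset.sup_le fun j _ => Finset.sup_le fun i hi => ?_
    have := h.2 (i, j) (mem_support_iff.1 hi)
    have h' : monDeg w (i, j) ≤ monDeg w m := by
      rcases this with h | h <;> omega
    exact_mod_cast h'
  · have h1 : (Q.coeff m.2).coeff m.1 ≠ 0 := h.1
    have h2 : Q.coeff m.2 ≠ 0 := fun h0 => h1 (by simp [h0])
    refine le_trans ?_ (Finset.le_sup (mem_support_iff.2 h2))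
    exact Finset.le_sup (f := fun i => ((monDeg w (i, m.2) : ℕ) : WithBot ℕ)) (mem_support_iff.2 h1)

lemma coeff_X_sub_C_smul (x₀ : F) (Q : F[X][Y]) (i j : ℕ) :
    (((X - C x₀) • Q).coeff j).coeff i =
      (if i = 0 then 0 else (Q.coeff j).coeff (i - 1)) - x₀ * (Q.coeff j).coeff i := by
  rw [coeff_smul, smul_eq_mul, sub_mul, coeff_sub, coeff_C_mul]
  cases i <;> simp

lemma coeff_C_mul_X_pow_smul (c : F) (a : ℕ) (Q : F[X][Y]) (i j : ℕ) :
    (((C c * X ^ a : F[X]) • Q).coeff j).coeff i =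
      if a ≤ i then c * (Q.coeff j).coeff (i - a) else 0 := by
  rw [coeff_smul, smul_eq_mul, mul_assoc, coeff_C_mul, coeff_X_pow_mul']
  split_ifs <;> simp

lemma IsLeadMon.X_sub_C_smul {Q : F[X][Y]} {i j : ℕ} (h : IsLeadMon w Q (i, j)) (x₀ : F) :
    IsLeadMon w ((X - C x₀) • Q) (i + 1, j) := by
  constructor
  · change (((X - C x₀) • Q).coeff j).coeff (i + 1) ≠ 0
    rw [coeff_X_sub_C_smul, h.coeff_eq_zero (i := i + 1) (j := j)
      (by rw [monKey_lt_iff]; simp only [monDeg]; omega)]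
    have h1 : (Q.coeff j).coeff i ≠ 0 := h.1
    simpa using h1
  · rintro ⟨i', j'⟩ hm
    rw [monLE_iff]
    by_contra hlt
    rw [not_le] at hlt
    refine hm ?_
    change (((X - C x₀) • Q).coeff j').coeff i' = 0
    rw [coeff_X_sub_C_smul, h.coeff_eq_zero (lt_of_le_of_lt (monKey_le_add i j 1) hlt)]
    cases i' with
    | zero => simp
    | succ k => simpa using h.coeff_eq_zero (monKey_add_lt_iff.1 hlt)

lemma IsLeadMon.sub_C_smul {P Q : F[X][Y]} {m m' : ℕ × ℕ} (h : IsLeadMon w Q m)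
    (h' : IsLeadMon w P m') (hlt : monKey w m' < monKey w m) (c : F) :
    IsLeadMon w (Q - (C c : F[X]) • P) m := by
  have key (i j : ℕ) : ((Q - (C c : F[X]) • P).coeff j).coeff i =
      (Q.coeff j).coeff i - c * (P.coeff j).coeff i := by
    simp
  constructor
  · change ((Q - (C c : F[X]) • P).coeff m.2).coeff m.1 ≠ 0
    rw [key, h'.coeff_eq_zero (i := m.1) (j := m.2) hlt]
    have h1 : (Q.coeff m.2).coeff m.1 ≠ 0 := h.1
    simpa using h1
  · rintro ⟨i, j⟩ hm
    rw [monLE_iff]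
    by_contra h1
    rw [not_le] at h1
    refine hm ?_
    change ((Q - (C c : F[X]) • P).coeff j).coeff i = 0
    rw [key, h'.coeff_eq_zero (hlt.trans h1), h.coeff_eq_zero h1]
    simp

/-- One step of the division of `Q` by `P`. -/
lemma IsLeadMon.exists_cancel (hw : 0 < w) {P Q : F[X][Y]} {i j a : ℕ}
    (hQ : IsLeadMon w Q (i + a, j)) (hP : IsLeadMon w P (i, j)) :
    ∃ c : F, c ≠ 0 ∧ ∀ m ∈ monomials (Q - (C c * X ^ a : F[X]) • P),
      monKey w m < monKey w (i + a, j) := by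
  have h1 : (Q.coeff j).coeff (i + a) ≠ 0 := hQ.1
  have h2 : (P.coeff j).coeff i ≠ 0 := hP.1
  refine ⟨(Q.coeff j).coeff (i + a) / (P.coeff j).coeff i, div_ne_zero h1 h2, ?_⟩
  rintro ⟨i', j'⟩ hm
  by_contra hlt
  rw [not_lt] at hlt
  refine hm ?_
  change ((Q - _).coeff j').coeff i' = 0
  rw [coeff_sub, coeff_sub, coeff_C_mul_X_pow_smul]
  rcases hlt.eq_or_lt with heq | hlt
  · have := monKey_injective hw heq
    simp only [Prod.mk.injEq] at this
    obtain ⟨rfl, rfl⟩ := this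
    rw [if_pos (by omega), Nat.add_sub_cancel, div_mul_cancel₀ _ h2, sub_self]
  · rw [hQ.coeff_eq_zero hlt]
    split_ifs with h
    -- A monomial above the leading one of `Q` that comes from `x ^ a * P` would come from a
    -- monomial of `P` above the leading one of `P`.
    · obtain ⟨k, rfl⟩ := Nat.exists_eq_add_of_le' h
      rw [Nat.add_sub_cancel, hP.coeff_eq_zero (monKey_add_lt_iff.1 hlt)]
      simp
    · simp

end LeadingMonomials

/-! ### Gröbner bases and the effect of one iteration -/

section GroebnerBases

variable {F : Type*} [Field F] {w : ℕ} {ι : Type*}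

/-- Leading monomials with the same power of `y` are always comparable for divisibility. Minimality
thus amounts to distinct exponents of `y`, a condition that the update preserves. -/
lemma IsMinGroebnerBasis.injective {b : ι → F[X][Y]} {N : Submodule F[X] F[X][Y]}
    (hb : IsMinGroebnerBasis w b N) {i e : ι → ℕ} (h : ∀ j, IsLeadMon w (b j) (i j, e j)) :
    Function.Injective e := by
  intro j k hjk
  by_contra hne
  rcases le_total (i j) (i k) with hle | hle
  · exact hb.2.2 j k _ _ hne (h j) (h k) ⟨hjk, hle⟩
  · exact hb.2.2 k j _ _ (Ne.symm hne) (h k) (h j) ⟨hjk.symm, hle⟩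

lemma IsGroebnerBasis.isMin (hw : 0 < w) {b : ι → F[X][Y]} {N : Submodule F[X] F[X][Y]}
    (hb : IsGroebnerBasis w b N) {i e : ι → ℕ} (h : ∀ j, IsLeadMon w (b j) (i j, e j))
    (he : Function.Injective e) : IsMinGroebnerBasis w b N := by
  refine ⟨hb, fun j => (h j).ne_zero, fun j k m m' hne hm hm' hdvd => hne (he ?_)⟩
  have := hdvd.1
  rwa [hm.eq hw (h j), hm'.eq hw (h k)] at this

variable {x₀ y₀ : F} {dx dy : ℕ}

/-- If the Hasse derivative vanishes for the elements of a Gröbner basis below a monomial, then it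
vanishes for all elements of the module below this monomial. -/
lemma IsGroebnerBasis.hasse_eq_zero (hw : 0 < w) {b : ι → F[X][Y]} {N : Submodule F[X] F[X][Y]}
    (hb : IsGroebnerBasis w b N) (hN : ∀ f ∈ N, ∀ a < dx, hasse x₀ y₀ a dy f = 0) (m : ℕ × ℕ)
    (hlow : ∀ j m', IsLeadMon w (b j) m' → monKey w m' < monKey w m →
      hasse x₀ y₀ dx dy (b j) = 0)
    {f : F[X][Y]} (hf : f ∈ N) (hfm : ∀ m' ∈ monomials f, monKey w m' < monKey w m) :
    hasse x₀ y₀ dx dy f = 0 := by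
  suffices H : ∀ k : ℕ ×ₗ ℕ, ∀ f ∈ N, ∀ m', IsLeadMon w f m' → monKey w m' = k →
      k < monKey w m → hasse x₀ y₀ dx dy f = 0 by
    by_cases h0 : f = 0
    · simp [h0]
    · obtain ⟨m', hm'⟩ := exists_isLeadMon w h0
      exact H _ f hf m' hm' rfl (hfm _ hm'.1)
  -- Division by the Gröbner basis, as a well-founded induction on the leading monomial: each step
  -- subtracts a multiple of a basis element whose leading monomial is at most that of `f`, so that
  -- its derivative vanishes.
  intro k
  induction k using WellFoundedLT.induction with
  | ind k ih =>
    rintro f hf m₁ hm₁ rfl hlt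
    obtain ⟨j, ⟨i, l⟩, m₂, hj, hm₂, hdvd⟩ := hb.2 f hf hm₁.ne_zero
    obtain rfl := hm₂.eq hw hm₁
    obtain ⟨i₂, l₂⟩ := m₂
    obtain ⟨rfl, hle⟩ : l = l₂ ∧ i ≤ i₂ := hdvd
    obtain ⟨a, rfl⟩ := Nat.exists_eq_add_of_le hle
    obtain ⟨c, -, hc⟩ := hm₁.exists_cancel hw hj
    have h1 : hasse x₀ y₀ dx dy (b j) = 0 :=
      hlow j _ hj (lt_of_le_of_lt (monKey_le_add i l a) hlt)
    have h2 : hasse x₀ y₀ dx dy ((C c * X ^ a : F[X]) • b j) = 0 := by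
      rw [hasse_smul_of_forall_lt x₀ y₀ (hN _ (hb.1 j)), h1, mul_zero]
    have h3 : hasse x₀ y₀ dx dy (f - (C c * X ^ a : F[X]) • b j) = 0 := by
      by_cases h0 : f - (C c * X ^ a : F[X]) • b j = 0
      · simp [h0]
      · obtain ⟨m', hm'⟩ := exists_isLeadMon w h0
        exact ih _ (hc m' hm'.1) _ (N.sub_mem hf (N.smul_mem _ (hb.1 j))) m' hm' rfl
          ((hc m' hm'.1).trans hlt)
    rwa [hasse_sub, h2, sub_zero] at h3

variable [DecidableEq ι]

/-- The basis after an iteration with the pivot `t` and the discrepancies `v`. -/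
noncomputable def updateBasis (x₀ : F) (t : ι) (v : ι → F) (b : ι → F[X][Y]) (j : ι) : F[X][Y] :=
  if j = t then (X - C x₀) • b t else b j - (C (v j / v t) : F[X]) • b t

lemma isLeadMon_updateBasis {b : ι → F[X][Y]} {i e : ι → ℕ}
    (h : ∀ j, IsLeadMon w (b j) (i j, e j)) {t : ι} {v : ι → F}
    (ht : ∀ j, j ≠ t → v j ≠ 0 → monKey w (i t, e t) < monKey w (i j, e j)) (j : ι) :
    IsLeadMon w (updateBasis x₀ t v b j) (if j = t then i t + 1 else i j, e j) := by
  rw [updateBasis]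
  split_ifs with hj
  · subst hj
    exact (h j).X_sub_C_smul x₀
  · by_cases hv : v j = 0
    · simpa [hv] using h j
    · exact (h j).sub_C_smul (h t) (ht j hj hv) _

lemma hasse_updateBasis (x₀ y₀ : F) (t : ι) (v : ι → F) (b : ι → F[X][Y]) (a c : ℕ) (j : ι) :
    hasse x₀ y₀ a c (updateBasis x₀ t v b j) =
      if j = t then (if a = 0 then 0 else hasse x₀ y₀ (a - 1) c (b t))
      else hasse x₀ y₀ a c (b j) - v j / v t * hasse x₀ y₀ a c (b t) := by
  rw [updateBasis]
  split_ifs with h1 h2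
  · rw [hasse_X_sub_C_smul, if_pos h2]
  · rw [hasse_X_sub_C_smul, if_neg h2]
  · rw [hasse_sub, hasse_C_smul]

/-- Only the divisor `b t` can fail, since only its leading monomial has changed. Failure would
produce an element of the kernel with the old leading monomial of `b t`. -/
lemma IsMinGroebnerBasis.updateBasis (hw : 0 < w) {b : ι → F[X][Y]}
    {N N' : Submodule F[X] F[X][Y]} (hb : IsMinGroebnerBasis w b N)
    (hN : ∀ f ∈ N, ∀ a < dx, hasse x₀ y₀ a dy f = 0)
    (hN' : ∀ f, f ∈ N' ↔ f ∈ N ∧ hasse x₀ y₀ dx dy f = 0)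
    {i e : ι → ℕ} (h : ∀ j, IsLeadMon w (b j) (i j, e j)) {t : ι} {v : ι → F}
    (hv : ∀ j, v j = hasse x₀ y₀ dx dy (b j)) (hvt : v t ≠ 0)
    (ht : ∀ j, v j ≠ 0 → monKey w (i t, e t) ≤ monKey w (i j, e j)) :
    IsMinGroebnerBasis w (updateBasis x₀ t v b) N' := by
  have he := hb.injective h
  have ht' : ∀ j, j ≠ t → v j ≠ 0 → monKey w (i t, e t) < monKey w (i j, e j) := by
    refine fun j hj hvj => lt_of_le_of_ne (ht j hvj) fun heq => hj (he ?_)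
    exact (congrArg Prod.snd (monKey_injective hw heq)).symm
  have hlead := isLeadMon_updateBasis (x₀ := x₀) h ht'
  refine IsGroebnerBasis.isMin hw ⟨fun j => (hN' _).2 ⟨?_, ?_⟩, fun f hf hf0 => ?_⟩ hlead he
  · rw [KNH.updateBasis]
    split_ifs
    · exact N.smul_mem _ (hb.1.1 t)
    · exact N.sub_mem (hb.1.1 j) (N.smul_mem _ (hb.1.1 t))
  · rw [hasse_updateBasis]
    split_ifs with h1 h2
    · rfl
    · exact hN _ (hb.1.1 t) _ (by omega)
    · rw [← hv, ← hv, div_mul_cancel₀ _ hvt, sub_self]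
  · obtain ⟨hfN, hfz⟩ := (hN' f).1 hf
    obtain ⟨j, m, m', hm, hm', hdvd⟩ := hb.1.2 f hfN hf0
    obtain rfl := hm.eq hw (h j)
    refine ⟨j, _, m', hlead j, hm', hdvd.1, ?_⟩
    obtain ⟨i', l⟩ := m'
    obtain ⟨rfl, hle⟩ : e j = l ∧ i j ≤ i' := hdvd
    split_ifs with hj
    · subst hj
      change i j + 1 ≤ i'
      by_contra hcon
      -- The `+ 0` matches the form of `exists_cancel` with cofactor `x ^ 0`: here `f` and `b j`
      -- have the same leading monomial.
      obtain rfl : i' = i j + 0 := by omega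
      obtain ⟨c, hc0, hc⟩ := hm'.exists_cancel hw (h j)
      have hz : hasse x₀ y₀ dx dy (f - (C c * X ^ 0 : F[X]) • b j) = 0 := by
        refine hb.1.hasse_eq_zero hw hN _ (fun k m₁ hk hlt => ?_)
          (N.sub_mem hfN (N.smul_mem _ (hb.1.1 j))) hc
        -- A basis element below the pivot with nonzero discrepancy would contradict the choice of
        -- the pivot.
        by_contra hne
        rw [← hv] at hne
        rw [hk.eq hw (h k)] at hlt
        exact absurd (ht k hne) (not_le.2 hlt)
      rw [pow_zero, mul_one, hasse_sub, hasse_C_smul, hfz, zero_sub, neg_eq_zero, ← hv] at hz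
      exact mul_ne_zero hc0 hvt hz
    · exact hle

end GroebnerBases

/-! ### The lexicographic list of orders -/

section Orders

variable {s : ℕ}

lemma mem_orders {d : Fin s × Fin s} : d ∈ orders s ↔ (d.1 : ℕ) + (d.2 : ℕ) < s := by
  rw [orders, List.mem_filter, decide_eq_true_eq, and_iff_right]
  exact List.pair_mem_product.2 ⟨List.mem_finRange _, List.mem_finRange _⟩

lemma length_orders_le (s : ℕ) : (orders s).length ≤ s ^ 2 :=
  (List.length_filter_le _ _).trans ((List.length_product _ _).trans_le (by simp [sq]))

lemma pairwise_orders (s : ℕ) : (orders s).Pairwise fun d d' => toLex d < toLex d' := by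
  refine List.Pairwise.filter _ ?_
  rw [List.product, List.pairwise_flatMap]
  refine ⟨fun a _ => ?_, ?_⟩
  · rw [List.pairwise_map]
    refine (List.pairwise_lt_finRange s).imp fun {c c'} h => ?_
    exact Prod.Lex.lt_iff.2 (Or.inr ⟨rfl, h⟩)
  · refine (List.pairwise_lt_finRange s).imp fun h x hx y hy => Prod.Lex.lt_iff.2 (Or.inl ?_)
    simp only [List.mem_map] at hx hy
    obtain ⟨_, -, rfl⟩ := hx
    obtain ⟨_, -, rfl⟩ := hy
    exact h

variable {pre suf : List (Fin s × Fin s)} {d : Fin s × Fin s}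

lemma fst_le_of_orders_eq (h : orders s = pre ++ d :: suf) {d' : Fin s × Fin s} (hd' : d' ∈ pre) :
    d'.1 ≤ d.1 := by
  have hp := pairwise_orders s
  rw [h, List.pairwise_append] at hp
  have := hp.2.2 d' hd' d (by simp)
  rcases Prod.Lex.lt_iff.1 this with h1 | h1
  · exact h1.le
  · exact h1.1.le

lemma mem_of_orders_eq (h : orders s = pre ++ d :: suf) {d' : Fin s × Fin s}
    (hlt : toLex d' < toLex d) (hs : (d'.1 : ℕ) + (d'.2 : ℕ) < s) : d' ∈ pre := by
  have hp := pairwise_orders s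
  have hm := mem_orders.2 hs
  rw [h, List.pairwise_append, List.pairwise_cons] at hp
  rw [h, List.mem_append, List.mem_cons] at hm
  rcases hm with hm | rfl | hm
  · exact hm
  · exact absurd hlt (lt_irrefl _)
  · exact absurd hlt (hp.2.1.1 d' hm).asymm

end Orders

/-! ### The chain of modules cut out by the iterations -/

section Modules

variable {F : Type*} [Field F] {s : ℕ}

/-- The elements of `N` whose Hasse derivatives of the orders in `ds` vanish, with those of lower
order in `x`. -/
noncomputable def vanishingModule (x₀ y₀ : F) (N : Submodule F[X] F[X][Y])
    (ds : List (Fin s × Fin s)) : Submodule F[X] F[X][Y] where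
  -- Including the lower orders `a` makes the set closed under `F[x]` for every list `ds`. For
  -- initial segments of `orders s` they are no additional condition.
  carrier := {f | f ∈ N ∧ ∀ d ∈ ds, ∀ a ≤ (d.1 : ℕ), hasse x₀ y₀ a d.2 f = 0}
  add_mem' := fun ⟨hf, hf'⟩ ⟨hg, hg'⟩ => ⟨N.add_mem hf hg, fun d hd a ha => by
    rw [hasse_add, hf' d hd a ha, hg' d hd a ha, add_zero]⟩
  zero_mem' := ⟨N.zero_mem, fun d _ a _ => by simp⟩
  smul_mem' := fun p f ⟨hf, hf'⟩ => ⟨N.smul_mem p hf, fun d hd a ha => by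
    rw [hasse_smul_of_forall_lt x₀ y₀ (fun a' ha' => hf' d hd a' (by omega)), hf' d hd a ha,
      mul_zero]⟩

lemma mem_vanishingModule {x₀ y₀ : F} {N : Submodule F[X] F[X][Y]} {ds : List (Fin s × Fin s)}
    {f : F[X][Y]} : f ∈ vanishingModule x₀ y₀ N ds ↔
      f ∈ N ∧ ∀ d ∈ ds, ∀ a ≤ (d.1 : ℕ), hasse x₀ y₀ a d.2 f = 0 := Iff.rfl

lemma vanishingModule_nil (x₀ y₀ : F) (N : Submodule F[X] F[X][Y]) :
    vanishingModule x₀ y₀ N ([] : List (Fin s × Fin s)) = N := by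
  ext f
  simp [mem_vanishingModule]

lemma vanishingModule_orders (x₀ y₀ : F) {N : Submodule F[X] F[X][Y]} {ℓ : ℕ}
    (hN : N ≤ degreeLE F[X] (ℓ : WithBot ℕ)) :
    vanishingModule x₀ y₀ N (orders s) = N ⊓ zeroModule ℓ s x₀ y₀ := by
  ext f
  rw [mem_vanishingModule, Submodule.mem_inf]
  refine and_congr_right fun hf => ⟨fun h => ⟨hN hf, fun dx dy hd => ?_⟩, fun h d hd a ha => ?_⟩
  · exact h (⟨dx, by omega⟩, ⟨dy, by omega⟩) (mem_orders.2 hd) dx le_rfl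
  · have := mem_orders.1 hd
    exact h.2 a d.2 (by omega)

variable {x₀ y₀ : F} {N : Submodule F[X] F[X][Y]} {pre suf : List (Fin s × Fin s)}
  {d : Fin s × Fin s}

/-- Every admissible order with a smaller `x`-part precedes `d` lexicographically, whatever its
`y`-part, and so already belongs to `pre`. -/
lemma hasse_eq_zero_of_mem_vanishingModule (h : orders s = pre ++ d :: suf) {f : F[X][Y]}
    (hf : f ∈ vanishingModule x₀ y₀ N pre) {a c : ℕ} (ha : a < (d.1 : ℕ)) (hac : a + c < s) :
    hasse x₀ y₀ a c f = 0 :=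
  hf.2 (⟨a, by omega⟩, ⟨c, by omega⟩)
    (mem_of_orders_eq h (Prod.Lex.lt_iff.2 (Or.inl ha)) hac) a le_rfl

lemma mem_vanishingModule_append (h : orders s = pre ++ d :: suf) (f : F[X][Y]) :
    f ∈ vanishingModule x₀ y₀ N (pre ++ [d]) ↔
      f ∈ vanishingModule x₀ y₀ N pre ∧ hasse x₀ y₀ d.1 d.2 f = 0 := by
  constructor
  · exact fun hf => ⟨⟨hf.1, fun d' hd' => hf.2 d' (by simp [hd'])⟩, hf.2 d (by simp) _ le_rfl⟩
  · rintro ⟨hf, hz⟩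
    refine ⟨hf.1, fun d' hd' a ha => ?_⟩
    rw [List.mem_append, List.mem_singleton] at hd'
    rcases hd' with hd' | rfl
    · exact hf.2 d' hd' a ha
    · rcases ha.eq_or_lt with rfl | ha
      · exact hz
      · have : d' ∈ orders s := by simp [h]
        have := mem_orders.1 this
        exact hasse_eq_zero_of_mem_vanishingModule h hf ha (by omega)

end Modules

/-! ### The loop invariant -/

section Loop

variable {F : Type*} [Field F] {ℓ s : ℕ}

lemma matApply_mul (T U : Matrix (Fin ℓ) (Fin ℓ) F[X]) (b : Fin ℓ → F[X][Y]) :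
    matApply (U * T) b = matApply U (matApply T b) := by
  funext j
  simp only [matApply, Matrix.mul_apply, Finset.sum_smul, Finset.smul_sum, mul_smul]
  exact Finset.sum_comm

@[simp] lemma matApply_one (b : Fin ℓ → F[X][Y]) : matApply 1 b = b := by
  funext j
  simp [matApply, Matrix.one_apply]

lemma sum_updateMatrix_smul {M : Type*} [AddCommGroup M] [Module F[X] M] (x₀ : F)
    (t : Fin (ℓ + 1)) (v : Fin (ℓ + 1) → F) (b : Fin (ℓ + 1) → M) (j : Fin (ℓ + 1)) :
    ∑ k, updateMatrix x₀ t v j k • b k =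
      if j = t then (X - C x₀) • b t else b j - (C (v j / v t) : F[X]) • b t := by
  simp only [updateMatrix, Matrix.sub_apply, Matrix.one_apply, Matrix.of_apply, sub_smul,
    Finset.sum_sub_distrib, ite_smul, one_smul, zero_smul, Finset.sum_ite_eq, Finset.mem_univ,
    if_true, Finset.sum_ite_eq']
  split_ifs with h
  · subst h
    abel
  · rfl

lemma matApply_updateMatrix (x₀ : F) (t : Fin (ℓ + 1)) (v : Fin (ℓ + 1) → F)
    (b : Fin (ℓ + 1) → F[X][Y]) :
    matApply (updateMatrix x₀ t v) b = updateBasis x₀ t v b := by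
  funext j
  rw [matApply, sum_updateMatrix_smul, updateBasis]

lemma updateMatrix_mul_apply (x₀ : F) (t : Fin (ℓ + 1)) (v : Fin (ℓ + 1) → F)
    (T : Matrix (Fin (ℓ + 1)) (Fin (ℓ + 1)) F[X]) (j k : Fin (ℓ + 1)) :
    (updateMatrix x₀ t v * T) j k =
      if j = t then (X - C x₀) * T t k else T j k - C (v j / v t) * T t k := by
  rw [Matrix.mul_apply]
  exact sum_updateMatrix_smul x₀ t v (fun i => T i k) j

variable [DecidableEq F]

lemma pivot_eq_some {e δ : Fin (ℓ + 1) → ℕ} {v : Fin (ℓ + 1) → F} {t : Fin (ℓ + 1)}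
    (h : pivot e δ v = some t) : v t ≠ 0 ∧ ∀ j, v j ≠ 0 →
      toLex (δ t, OrderDual.toDual (e t)) ≤ toLex (δ j, OrderDual.toDual (e j)) := by
  refine ⟨by simpa using List.argmin_mem h, fun j hj => ?_⟩
  exact List.le_of_mem_argmin (f := fun j => toLex (δ j, OrderDual.toDual (e j)))
    (by simpa using hj) h

lemma pivot_eq_none {e δ : Fin (ℓ + 1) → ℕ} {v : Fin (ℓ + 1) → F} (h : pivot e δ v = none)
    (j : Fin (ℓ + 1)) : v j = 0 := by
  rw [pivot, List.argmin_eq_none, List.filter_eq_nil_iff] at h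
  simpa using h j (List.mem_finRange j)

variable {x₀ : F} {e : Fin (ℓ + 1) → ℕ} {σ : LoopState F ℓ s} {d : Fin s × Fin s}

lemma LoopState.step_of_pivot_eq_none (h : σ.pivot e d = none) : σ.step x₀ e d = σ := by
  simp [LoopState.step, h]

lemma LoopState.step_of_pivot_eq_some {t : Fin (ℓ + 1)} (h : σ.pivot e d = some t) :
    σ.step x₀ e d =
    { H := fun j =>
        if j = t then Matrix.of (shiftDown 0 (σ.H t))
        else σ.H j - (σ.H j d.1 d.2 / σ.H t d.1 d.2) • σ.H t
      T := updateMatrix x₀ t (fun j => σ.H j d.1 d.2) * σ.T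
      δ := Function.update σ.δ t (σ.δ t + 1) } := by
  simp [LoopState.step, h]

lemma matApply_step {t : Fin (ℓ + 1)} (h : σ.pivot e d = some t) (b : Fin (ℓ + 1) → F[X][Y]) :
    matApply (σ.step x₀ e d).T b =
      updateBasis x₀ t (fun j => σ.H j d.1 d.2) (matApply σ.T b) := by
  rw [LoopState.step_of_pivot_eq_some h, matApply_mul, matApply_updateMatrix]

/-- What holds during the loop, after the iterations for the members of `pre`. -/
structure LoopInvariant (w : ℕ) (x₀ y₀ : F) (b : Fin (ℓ + 1) → F[X][Y])
    (N : Submodule F[X] F[X][Y]) (δ e : Fin (ℓ + 1) → ℕ) (pre : List (Fin s × Fin s))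
    (σ : LoopState F ℓ s) : Prop where
  isMin : IsMinGroebnerBasis w (matApply σ.T b) (vanishingModule x₀ y₀ N pre)
  lead : ∀ j, ∃ i, IsLeadMon w (matApply σ.T b j) (i, e j) ∧ σ.δ j = i + w * e j
  -- Entries with `a + c ≥ s` are left unspecified: the row shift may fill them, but no iteration
  -- reads them.
  hasse : ∀ j, ∀ a c : Fin s, (a : ℕ) + c < s → σ.H j a c = hasse x₀ y₀ a c (matApply σ.T b j)
  -- Here `a` is the current order in `x`. The second alternative describes an element that has been
  -- pivot for this `a`; its row `a` is zero, so it cannot be pivot again before `a` increases.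
  growth : ∀ a : ℕ, (∀ d ∈ pre, (d.1 : ℕ) ≤ a) → ∀ j,
    ((∀ k, (σ.T j k).natDegree ≤ a) ∧ σ.δ j ≤ δ j + a) ∨
    ((∀ k, (σ.T j k).natDegree ≤ a + 1) ∧ σ.δ j ≤ δ j + (a + 1) ∧
      ∀ c, a + c < s → KNH.hasse x₀ y₀ a c (matApply σ.T b j) = 0)

variable {w : ℕ} {y₀ : F} {b : Fin (ℓ + 1) → F[X][Y]} {N : Submodule F[X] F[X][Y]}
  {δ : Fin (ℓ + 1) → ℕ} {pre suf : List (Fin s × Fin s)}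

omit [DecidableEq F] in
lemma LoopInvariant.wdeg_eq (h : LoopInvariant w x₀ y₀ b N δ e pre σ) (j : Fin (ℓ + 1)) :
    wdeg w (matApply σ.T b j) = (σ.δ j : WithBot ℕ) := by
  obtain ⟨i, hi, hδ⟩ := h.lead j
  rw [hi.wdeg_eq, hδ, monDeg]

omit [DecidableEq F] in
lemma LoopInvariant.init (hb : IsMinGroebnerBasis w b N)
    (hδ : ∀ j, wdeg w (b j) = (δ j : WithBot ℕ)) (he : ∀ j, ∃ i, IsLeadMon w (b j) (i, e j)) :
    LoopInvariant w x₀ y₀ b N δ e []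
      (initState s x₀ y₀ (fun j => modX (b j) ((X - C x₀) ^ s)) δ) where
  isMin := by
    rwa [vanishingModule_nil, initState, matApply_one]
  lead j := by
    obtain ⟨i, hi⟩ := he j
    refine ⟨i, by simpa [initState] using hi, ?_⟩
    have h := hδ j
    rw [hi.wdeg_eq, monDeg] at h
    exact_mod_cast h.symm
  hasse j a c hac := by
    simp [initState, hac, hasse_modX x₀ y₀ a.2]
  growth a _ j := Or.inl ⟨fun k => by
    simp only [initState, Matrix.one_apply]
    split_ifs <;> simp, by simp [initState]⟩

omit [DecidableEq F] in
/-- At the pivot, and at the elements with a nonzero discrepancy, the first alternative of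
`LoopInvariant.growth` holds for the current order in `x`. -/
lemma LoopInvariant.fresh (h : LoopInvariant w x₀ y₀ b N δ e pre σ)
    (ho : orders s = pre ++ d :: suf) {j : Fin (ℓ + 1)} (hj : σ.H j d.1 d.2 ≠ 0) :
    (∀ k, (σ.T j k).natDegree ≤ (d.1 : ℕ)) ∧ σ.δ j ≤ δ j + (d.1 : ℕ) := by
  have hd : (d.1 : ℕ) + d.2 < s := mem_orders.1 (by simp [ho])
  rcases h.growth d.1 (fun d' hd' => fst_le_of_orders_eq ho hd') j with h1 | h1
  · exact h1
  · rw [h.hasse j d.1 d.2 hd] at hj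
    exact absurd (h1.2.2 d.2 hd) hj

omit [DecidableEq F] in
lemma growth_mono {T : Fin (ℓ + 1) → F[X]} {D D₀ a a' : ℕ} {Q : F[X][Y]} (haa' : a < a')
    (h : ((∀ k, (T k).natDegree ≤ a) ∧ D ≤ D₀ + a) ∨
      ((∀ k, (T k).natDegree ≤ a + 1) ∧ D ≤ D₀ + (a + 1) ∧
        ∀ c, a + c < s → KNH.hasse x₀ y₀ a c Q = 0)) :
    (∀ k, (T k).natDegree ≤ a') ∧ D ≤ D₀ + a' := by
  rcases h with ⟨h1, h2⟩ | ⟨h1, h2, -⟩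
  · exact ⟨fun k => (h1 k).trans haa'.le, by omega⟩
  · exact ⟨fun k => (h1 k).trans haa', by omega⟩

lemma LoopInvariant.step (hw : 0 < w) (h : LoopInvariant w x₀ y₀ b N δ e pre σ)
    (ho : orders s = pre ++ d :: suf) :
    LoopInvariant w x₀ y₀ b N δ e (pre ++ [d]) (σ.step x₀ e d) := by
  have hd : (d.1 : ℕ) + d.2 < s := mem_orders.1 (by simp [ho])
  have hpre : ∀ d' ∈ pre, (d'.1 : ℕ) ≤ d.1 := fun d' hd' => fst_le_of_orders_eq ho hd'
  have hv : ∀ j, σ.H j d.1 d.2 = KNH.hasse x₀ y₀ d.1 d.2 (matApply σ.T b j) :=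
    fun j => h.hasse j d.1 d.2 hd
  choose i hi hδ using h.lead
  cases hp : σ.pivot e d with
  | none =>
    have hz := pivot_eq_none hp
    rw [LoopState.step_of_pivot_eq_none hp]
    refine ⟨?_, h.lead, h.hasse, fun a ha => h.growth a fun d' hd' => ha d' (by simp [hd'])⟩
    refine IsGroebnerBasis.isMin hw ⟨fun j => ?_, fun f hf hf0 => ?_⟩ hi (h.isMin.injective hi)
    · exact (mem_vanishingModule_append ho _).2 ⟨h.isMin.1.1 j, by rw [← hv]; exact hz j⟩
    · exact h.isMin.1.2 f ((mem_vanishingModule_append ho f).1 hf).1 hf0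
  | some t =>
    obtain ⟨hvt, ht⟩ := pivot_eq_some hp
    have htk : ∀ j, σ.H j d.1 d.2 ≠ 0 → monKey w (i t, e t) ≤ monKey w (i j, e j) := by
      intro j hj
      have h1 := ht j hj
      rw [Prod.Lex.toLex_le_toLex, hδ, hδ] at h1
      rw [← monLE_iff]
      -- For equal weighted degrees `i + w * e`, the larger `e` gives the smaller `i`, hence the
      -- smaller monomial.
      rcases h1 with h1 | ⟨h1, h2⟩
      · exact Or.inl h1
      · have h3 : w * e j ≤ w * e t := Nat.mul_le_mul_left _ h2
        exact Or.inr ⟨h1, show i t ≤ i j by omega⟩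
    have hne : ∀ j, j ≠ t → σ.H j d.1 d.2 ≠ 0 →
        monKey w (i t, e t) < monKey w (i j, e j) := by
      refine fun j hj hvj => lt_of_le_of_ne (htk j hvj) fun heq => hj (h.isMin.injective hi ?_)
      exact (congrArg Prod.snd (monKey_injective hw heq)).symm
    have hB := matApply_step (x₀ := x₀) hp b
    have hlow : ∀ f ∈ vanishingModule x₀ y₀ N pre, ∀ a < (d.1 : ℕ), KNH.hasse x₀ y₀ a d.2 f = 0 :=
      fun f hf a ha => hasse_eq_zero_of_mem_vanishingModule ho hf ha (by omega)
    refine ⟨?_, fun j => ?_, fun j a c hac => ?_, ?_⟩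
    · rw [hB]
      exact h.isMin.updateBasis hw hlow (mem_vanishingModule_append ho) hi hv hvt htk
    · refine ⟨_, by rw [hB]; exact isLeadMon_updateBasis hi hne j, ?_⟩
      rw [LoopState.step_of_pivot_eq_some hp]
      change Function.update σ.δ t (σ.δ t + 1) j = _
      split_ifs with hj
      · subst hj
        rw [Function.update_self, hδ]
        omega
      · rw [Function.update_of_ne hj, hδ]
    · rw [hB, hasse_updateBasis, LoopState.step_of_pivot_eq_some hp]
      by_cases hj : j = t
      · simp only [hj, if_true, Matrix.of_apply, shiftDown]
        split_ifs with h0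
        · rfl
        · exact h.hasse t ⟨a - 1, by omega⟩ c (show (a : ℕ) - 1 + c < s by omega)
      · simp only [if_neg hj, Matrix.sub_apply, Matrix.smul_apply, smul_eq_mul, h.hasse j a c hac,
          h.hasse t a c hac]
    · have hcur : ∀ j,
          ((∀ k, ((σ.step x₀ e d).T j k).natDegree ≤ (d.1 : ℕ)) ∧
            (σ.step x₀ e d).δ j ≤ δ j + d.1) ∨
          ((∀ k, ((σ.step x₀ e d).T j k).natDegree ≤ (d.1 : ℕ) + 1) ∧
            (σ.step x₀ e d).δ j ≤ δ j + (d.1 + 1) ∧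
            ∀ c, (d.1 : ℕ) + c < s →
              KNH.hasse x₀ y₀ d.1 c (matApply (σ.step x₀ e d).T b j) = 0) := by
        intro j
        obtain ⟨hT, hδt⟩ := h.fresh ho hvt
        simp only [hB, hasse_updateBasis]
        rw [LoopState.step_of_pivot_eq_some hp]
        simp only [updateMatrix_mul_apply]
        by_cases hj : j = t
        · subst hj
          simp only [if_true, Function.update_self]
          refine Or.inr ⟨fun k => ?_, by omega, fun c hc => ?_⟩
          · refine natDegree_mul_le.trans ?_
            rw [natDegree_X_sub_C, add_comm]
            exact Nat.add_le_add_right (hT k) 1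
          -- Row `dx` of the multiple by `x - x₀` is the old row `dx - 1`, which vanishes on the
          -- current module.
          · split_ifs with h0
            · rfl
            · exact hasse_eq_zero_of_mem_vanishingModule ho (h.isMin.1.1 j) (by omega) (by omega)
        · simp only [if_neg hj, Function.update_of_ne hj]
          by_cases hvj : σ.H j d.1 d.2 = 0
          -- With discrepancy zero the element and its row of `T` are unchanged, so both
          -- alternatives persist. Otherwise the element and the pivot are both in the first
          -- alternative.
          · simpa [hvj] using h.growth d.1 hpre j
          · obtain ⟨hTj, hδj⟩ := h.fresh ho hvj
            refine Or.inl ⟨fun k => (natDegree_sub_le _ _).trans (max_le (hTj k) ?_), hδj⟩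
            exact (natDegree_C_mul_le _ _).trans (hT k)
      intro a ha j
      -- Once `a` exceeds the order in `x` of `d`, either alternative at that order gives the first
      -- one at `a`.
      rcases (ha d (by simp)).eq_or_lt with rfl | hlt
      · exact hcur j
      · exact Or.inl (growth_mono hlt (hcur j))

lemma loop_append (s : ℕ) (x₀ y₀ : F) (bhat : Fin (ℓ + 1) → F[X][Y]) (δ e : Fin (ℓ + 1) → ℕ)
    (pre : List (Fin s × Fin s)) (d : Fin s × Fin s) :
    loop s x₀ y₀ bhat δ e (pre ++ [d]) = (loop s x₀ y₀ bhat δ e pre).step x₀ e d := by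
  simp [loop]

lemma loopInvariant_loop (hw : 0 < w) (hb : IsMinGroebnerBasis w b N)
    (hδ : ∀ j, wdeg w (b j) = (δ j : WithBot ℕ)) (he : ∀ j, ∃ i, IsLeadMon w (b j) (i, e j))
    (pre : List (Fin s × Fin s)) : ∀ suf, orders s = pre ++ suf →
    LoopInvariant w x₀ y₀ b N δ e pre
      (loop s x₀ y₀ (fun j => modX (b j) ((X - C x₀) ^ s)) δ e pre) := by
  induction pre using List.reverseRecOn with
  | nil => exact fun _ _ => LoopInvariant.init hb hδ he
  | append_singleton pre d ih =>
    intro suf h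
    rw [List.append_assoc, List.singleton_append] at h
    rw [loop_append]
    exact (ih _ h).step hw h

lemma LoopInvariant.wdeg_step (hw : 0 < w) (h : LoopInvariant w x₀ y₀ b N δ e pre σ)
    (ho : orders s = pre ++ d :: suf) (j : Fin (ℓ + 1)) :
    (σ.pivot e d = some j →
      wdeg w (matApply (σ.step x₀ e d).T b j) = wdeg w (matApply σ.T b j) + 1) ∧
    (σ.pivot e d ≠ some j →
      wdeg w (matApply (σ.step x₀ e d).T b j) = wdeg w (matApply σ.T b j)) := by
  rw [(h.step hw ho).wdeg_eq, h.wdeg_eq]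
  constructor
  · intro hp
    rw [LoopState.step_of_pivot_eq_some hp]
    simp
  · intro hp
    cases hp' : σ.pivot e d with
    | none => rw [LoopState.step_of_pivot_eq_none hp']
    | some t =>
      rw [LoopState.step_of_pivot_eq_some hp']
      have : j ≠ t := fun hjt => hp (by rw [hp', hjt])
      simp [Function.update_of_ne this]

omit [DecidableEq F] in
lemma LoopInvariant.growth_orders (hs : 0 < s)
    (h : LoopInvariant w x₀ y₀ b N δ e (orders s) σ) (j : Fin (ℓ + 1)) :
    (∀ k, (σ.T j k).natDegree ≤ s) ∧ σ.δ j ≤ δ j + s :=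
  growth_mono (Nat.sub_one_lt_of_lt hs) (h.growth (s - 1) (fun d _ => by omega) j)

end Loop

/-! ### Values and costs of composed programs -/

namespace FieldProg

variable {F α β : Type*} [Field F] [DecidableEq F]

lemma eval_bind (p : FieldProg F α) (f : α → FieldProg F β) :
    (p.bind f).eval = (f p.eval).eval := by
  induction p with
  | ret a => rfl
  | zero k ih => exact ih _
  | one k ih => exact ih _
  | arith o x y k ih => exact ih _
  | isZero x k ih => exact ih _
  | lt m n k ih => exact ih _
  | succ n k ih => exact ih _

lemma cost_bind (p : FieldProg F α) (f : α → FieldProg F β) :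
    (p.bind f).cost = p.cost + (f p.eval).cost := by
  induction p with
  | ret a => simp [bind, cost, eval]
  | zero k ih => simp only [bind, cost, eval, ih]; omega
  | one k ih => simp only [bind, cost, eval, ih]; omega
  | arith o x y k ih => simp only [bind, cost, eval, ih]; omega
  | isZero x k ih => simp only [bind, cost, eval, ih]; omega
  | lt m n k ih => simp only [bind, cost, eval, ih]; omega
  | succ n k ih => simp only [bind, cost, eval, ih]; omega

lemma eval_tab (n : ℕ) (f : Fin n → FieldProg F α) : (tab n f).eval = fun i => (f i).eval := by
  induction n with
  | zero => exact funext fun i => i.elim0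
  | succ n ih =>
    funext i
    simp only [tab, eval_bind, eval, ih]
    refine Fin.cases ?_ (fun i => ?_) i <;> simp

lemma cost_tab_le (n : ℕ) (f : Fin n → FieldProg F α) (c : ℕ) (h : ∀ i, (f i).cost ≤ c) :
    (tab n f).cost ≤ n * c := by
  induction n with
  | zero => simp [tab, cost]
  | succ n ih =>
    simp only [tab, cost_bind, cost]
    have h1 := ih (fun i => f i.succ) fun i => h _
    have h2 := h 0
    rw [Nat.succ_mul]
    omega

lemma eval_fold (f : β → α → FieldProg F β) (l : List α) (b : β) :
    (fold f b l).eval = l.foldl (fun b a => (f b a).eval) b := by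
  induction l generalizing b with
  | nil => rfl
  | cons a l ih => rw [fold, eval_bind, ih, List.foldl_cons]

lemma cost_fold_append (f : β → α → FieldProg F β) (l : List α) (a : α) (b : β) :
    (fold f b (l ++ [a])).cost = (fold f b l).cost + (f (fold f b l).eval a).cost := by
  induction l generalizing b with
  | nil => simp [fold, cost_bind, cost, eval]
  | cons a l ih =>
    rw [List.cons_append, fold, fold, cost_bind, cost_bind, eval_bind, ih, add_assoc]

lemma cost_fold_le (f : β → α → FieldProg F β) (c : ℕ) (h : ∀ b a, (f b a).cost ≤ c) (l : List α)
    (b : β) : (fold f b l).cost ≤ l.length * c := by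
  induction l generalizing b with
  | nil => simp [fold, cost]
  | cons a l ih =>
    rw [fold, cost_bind, List.length_cons, Nat.succ_mul]
    have h1 := ih (f b a).eval
    have h2 := h b a
    omega

end FieldProg

open FieldProg

/-! ### Hasse derivatives by repeated Taylor shifts -/

section Taylor

lemma coeff_comp_X_add_C {R : Type*} [CommRing R] {n : ℕ} (p : Fin n → R) (r : R) (b : ℕ) :
    ((∑ k : Fin n, C (p k) * X ^ (k : ℕ)).comp (X + C r)).coeff b =
      ∑ k : Fin n, p k * (r ^ ((k : ℕ) - b) * ((k : ℕ).choose b : R)) := by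
  simp [Polynomial.sum_comp, finsetSum_coeff, coeff_X_add_C_pow]

lemma sum_C_mul_X_pow_eq_of_coeff_eq_zero {R : Type*} [CommRing R] {n : ℕ} {p : R[X]}
    (hp : ∀ i, n ≤ i → p.coeff i = 0) : ∑ k : Fin n, C (p.coeff k) * X ^ (k : ℕ) = p := by
  rw [Fin.sum_univ_eq_sum_range (fun k => C (p.coeff k) * X ^ k)]
  ext i
  simp only [finsetSum_coeff, coeff_C_mul, coeff_X_pow, mul_ite, mul_one, mul_zero,
    Finset.sum_ite_eq, Finset.mem_range]
  split_ifs with h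
  · rfl
  · exact (hp i (by omega)).symm

variable {F : Type*} [Field F]

/-- The two translations separate: shift every coefficient of `Q` in `x`, then, for fixed `a`, shift
in `y` the polynomial formed by the coefficients at `x ^ a`. `hasseProg` computes in this order. -/
lemma hasse_eq_coeff (x₀ y₀ : F) {Q : F[X][Y]} {n : ℕ} (hQ : ∀ k, n ≤ k → Q.coeff k = 0)
    (a b : ℕ) : hasse x₀ y₀ a b Q =
      ((∑ k : Fin n, C (((Q.coeff k).comp (X + C x₀)).coeff a) * X ^ (k : ℕ)).comp
        (X + C y₀)).coeff b := by
  rw [coeff_comp_X_add_C, hasse, translate]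
  conv_lhs => rw [← sum_C_mul_X_pow_eq_of_coeff_eq_zero hQ]
  simp only [Polynomial.map_sum, Polynomial.map_mul, map_C, Polynomial.map_pow, map_X]
  rw [coeff_comp_X_add_C, finsetSum_coeff]
  refine Finset.sum_congr rfl fun k _ => ?_
  rw [← C_pow, ← map_natCast (C : F →+* F[X]), ← C_mul, coeff_mul_C]
  rfl

variable [DecidableEq F]

lemma eval_taylorProg (s : ℕ) (x₀ : F) (n : ℕ) (c : Fin n → F) :
    (taylorProg s 0 x₀ n c).eval = fun d : Fin s =>
      ((∑ i : Fin n, C (c i) * X ^ (i : ℕ)).comp (X + C x₀)).coeff d := by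
  induction n with
  | zero => simp [taylorProg, FieldProg.eval]
  | succ n ih =>
    funext d
    have h : ∑ i : Fin (n + 1), C (c i) * X ^ (i : ℕ) =
        C (c 0) + X * ∑ i : Fin n, C (c i.succ) * X ^ (i : ℕ) := by
      rw [Fin.sum_univ_succ, Finset.mul_sum]
      simp only [Fin.val_zero, pow_zero, mul_one, Fin.val_succ, pow_succ]
      congr 1
      exact Finset.sum_congr rfl fun i _ => by ring
    rw [h, add_comp, mul_comp, X_comp, C_comp]
    simp only [taylorProg, eval_bind, eval_tab, FieldProg.eval, FieldOp.eval, ih]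
    set q := (∑ i : Fin n, C (c i.succ) * X ^ (i : ℕ)).comp (X + C x₀)
    obtain ⟨d, hd⟩ := d
    rw [coeff_add, add_mul, coeff_add, coeff_C_mul]
    cases d with
    | zero => simp [add_comm]
    | succ d => simp [add_comm]

lemma cost_taylorProg_le (s : ℕ) (z x₀ : F) (n : ℕ) (c : Fin n → F) :
    (taylorProg s z x₀ n c).cost ≤ n * (s * 2) := by
  induction n with
  | zero => simp [taylorProg, cost]
  | succ n ih =>
    rw [taylorProg, cost_bind, Nat.succ_mul]
    refine Nat.add_le_add (ih _) (cost_tab_le _ _ _ fun d => ?_)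
    simp [cost]

lemma eval_hasseProg {ℓ s : ℕ} (x₀ y₀ : F) {Q : F[X][Y]} (hQ : ∀ k, ℓ + 1 ≤ k → Q.coeff k = 0)
    (hQs : ∀ k i, s ≤ i → (Q.coeff k).coeff i = 0) :
    (hasseProg 0 x₀ y₀ fun (k : Fin (ℓ + 1)) (i : Fin s) => (Q.coeff k).coeff i).eval =
      fun a b : Fin s => if (a : ℕ) + b < s then hasse x₀ y₀ a b Q else 0 := by
  funext a b
  simp only [hasseProg, eval_bind, eval_tab, FieldProg.eval, eval_taylorProg]
  congr 1
  rw [hasse_eq_coeff x₀ y₀ hQ]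
  congr 2
  refine Finset.sum_congr rfl fun k _ => ?_
  rw [sum_C_mul_X_pow_eq_of_coeff_eq_zero (hQs k)]

lemma cost_hasseProg_le {ℓ s : ℕ} (z x₀ y₀ : F) (c : Fin (ℓ + 1) → Fin s → F) :
    (hasseProg z x₀ y₀ c).cost ≤ 4 * (ℓ + 1) * s ^ 2 := by
  simp only [hasseProg, cost_bind, cost, add_zero]
  refine (Nat.add_le_add (cost_tab_le _ _ _ fun k => cost_taylorProg_le _ _ _ _ _)
    (cost_tab_le _ _ _ fun a => cost_taylorProg_le _ _ _ _ _)).trans_eq ?_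
  ring

end Taylor

/-! ### Simulation and amortized cost of one iteration -/

section Steps

variable {F : Type*} [Field F] [DecidableEq F]

lemma eval_subMulProg {n : ℕ} (q : F) (g h : Fin n → F) :
    (subMulProg q g h).eval = fun i => g i - q * h i := by
  simp [subMulProg, eval_tab, FieldProg.eval, FieldOp.eval]

lemma cost_subMulProg_le {n : ℕ} (q : F) (g h : Fin n → F) : (subMulProg q g h).cost ≤ n * 2 :=
  cost_tab_le _ _ _ fun i => by simp [cost]

lemma eval_mulLinProg {n : ℕ} (x₀ : F) (p : Fin n → F) :
    (mulLinProg 0 x₀ p).eval = fun i : Fin n =>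
      (if i.val = 0 then 0 else p ⟨i.val - 1, by omega⟩) - x₀ * p i := by
  simp [mulLinProg, eval_tab, FieldProg.eval, FieldOp.eval]

lemma cost_mulLinProg_le {n : ℕ} (z x₀ : F) (p : Fin n → F) :
    (mulLinProg z x₀ p).cost ≤ n * 2 :=
  cost_tab_le _ _ _ fun i => by simp [cost]

variable {ℓ s : ℕ}

lemma eval_betterProg (e δ : Fin (ℓ + 1) → ℕ) (j i : Fin (ℓ + 1)) :
    (betterProg e δ j i : FieldProg F Bool).eval =
      decide (toLex (δ j, OrderDual.toDual (e j)) < toLex (δ i, OrderDual.toDual (e i))) := by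
  rw [Bool.eq_iff_iff, decide_eq_true_iff, Prod.Lex.toLex_lt_toLex]
  simp only [betterProg, FieldProg.eval, OrderDual.toDual_lt_toDual]
  by_cases h1 : δ j < δ i
  · simp [h1, FieldProg.eval]
  · by_cases h2 : δ i < δ j
    · have : δ j ≠ δ i := h2.ne'
      simp [h1, h2, this, FieldProg.eval]
    · have : δ j = δ i := by omega
      simp [this, FieldProg.eval]

lemma cost_betterProg_le (e δ : Fin (ℓ + 1) → ℕ) (j i : Fin (ℓ + 1)) :
    (betterProg e δ j i : FieldProg F Bool).cost ≤ 3 := by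
  simp only [betterProg, cost]
  split_ifs
  · simp [cost]
  · simp only [cost]
    split_ifs <;> simp [cost]

lemma eval_pivotProg (e δ : Fin (ℓ + 1) → ℕ) (v : Fin (ℓ + 1) → F) :
    (pivotProg e δ v).eval = pivot e δ v := by
  -- `List.argmin` is itself a left fold, so the filter for nonzero entries can be absorbed into its
  -- body and the two bodies compared.
  rw [pivotProg, eval_fold, pivot, List.argmin, List.foldl_filter]
  congr 1
  funext best j
  simp only [FieldProg.eval]
  by_cases hv : v j = 0
  · simp [hv, FieldProg.eval]
  · cases best with
    | none => simp [hv, FieldProg.eval, List.argAux]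
    | some i =>
      simp only [hv, decide_false, Bool.false_eq_true, if_false, eval_bind, eval_betterProg,
        FieldProg.eval, List.argAux, decide_eq_true_eq, ne_eq, not_false_eq_true, decide_true,
        if_true]

lemma cost_pivotProg_le (e δ : Fin (ℓ + 1) → ℕ) (v : Fin (ℓ + 1) → F) :
    (pivotProg e δ v).cost ≤ (ℓ + 1) * 4 := by
  refine (cost_fold_le _ 4 (fun best j => ?_) _ _).trans_eq (by rw [List.length_finRange])
  simp only [cost]
  by_cases hv : v j = 0
  · simp [hv, cost]
  · cases best with
    | none => simp [hv, cost]
    | some i =>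
      have := cost_betterProg_le (F := F) e δ j i
      simp only [hv, decide_false, Bool.false_eq_true, if_false, cost_bind, cost]
      omega

/-- The state `σ'` of the program stores the state `σ` of the loop. -/
structure ProgState.Represents (σ' : ProgState F ℓ s) (σ : LoopState F ℓ s) : Prop where
  H : ∀ j a c, σ'.H j a c = σ.H j a c
  -- Only coefficients up to `x ^ s` are compared. Row operations and multiplication by `x - x₀`
  -- commute with this truncation, so no degree bound is needed until the output.
  T : ∀ j k i, σ'.T j k i = (σ.T j k).coeff (i : ℕ)
  δ : σ'.δ = σ.δ

variable {σ' : ProgState F ℓ s} {σ : LoopState F ℓ s}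

lemma ProgState.Represents.eval_pivotProg (h : σ'.Represents σ) (e : Fin (ℓ + 1) → ℕ)
    (d : Fin s × Fin s) :
    (pivotProg e σ'.δ fun j => σ'.H j d.1 d.2).eval = σ.pivot e d := by
  rw [KNH.eval_pivotProg, h.δ, LoopState.pivot]
  simp only [h.H]

lemma ProgState.Represents.step (h : σ'.Represents σ) (x₀ : F) (e : Fin (ℓ + 1) → ℕ)
    (d : Fin s × Fin s) : (stepProg 0 x₀ e σ' d).eval.Represents (σ.step x₀ e d) := by
  rw [stepProg, eval_bind, h.eval_pivotProg]
  cases hp : σ.pivot e d with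
  | none => rwa [LoopState.step_of_pivot_eq_none hp]
  | some t =>
    rw [LoopState.step_of_pivot_eq_some hp]
    simp only [eval_bind, eval_tab, FieldProg.eval, FieldOp.eval]
    refine ⟨fun j a c => ?_, fun j k i => ?_, by simp [h.δ]⟩
    · by_cases hj : j = t
      · simp [hj, shiftDown, h.H, FieldProg.eval]
      · simp [hj, eval_tab, eval_subMulProg, h.H]
    · simp only [updateMatrix_mul_apply]
      by_cases hj : j = t
      · simp only [hj, if_true, eval_mulLinProg, h.T, sub_mul, coeff_sub, coeff_C_mul]
        obtain ⟨i, hi⟩ := i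
        cases i <;> simp
      · simp [hj, eval_subMulProg, h.T, h.H]

/-- Amortization with the potential `∑ j, σ.δ j`: a pivot raises it by one, which pays `2 * (ℓ + 1)
* s ^ 2` for the update of the `H j`. Charged to every iteration are the search (`4` per element),
the quotients (`1` per element), the update of `T`, and one degree increment. -/
lemma cost_stepProg_le (h : σ'.Represents σ) (z x₀ : F) (e : Fin (ℓ + 1) → ℕ)
    (d : Fin s × Fin s) :
    (stepProg z x₀ e σ' d).cost + (∑ j, σ.δ j) * (2 * (ℓ + 1) * s ^ 2) ≤
      (5 * (ℓ + 1) + 2 * (ℓ + 1) ^ 2 * (s + 1) + 1) +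
        (∑ j, (σ.step x₀ e d).δ j) * (2 * (ℓ + 1) * s ^ 2) := by
  rw [stepProg, cost_bind, h.eval_pivotProg]
  have h1 := cost_pivotProg_le e σ'.δ fun j => σ'.H j d.1 d.2
  cases hp : σ.pivot e d with
  | none =>
    rw [LoopState.step_of_pivot_eq_none hp]
    simp only [cost]
    have : 0 ≤ 2 * (ℓ + 1) ^ 2 * (s + 1) := Nat.zero_le _
    omega
  | some t =>
    have hδ : ∑ j, (σ.step x₀ e d).δ j = (∑ j, σ.δ j) + 1 := by
      rw [LoopState.step_of_pivot_eq_some hp]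
      change ∑ j, Function.update σ.δ t (σ.δ t + 1) j = _
      rw [Finset.sum_update_of_mem (Finset.mem_univ t),
        ← Finset.add_sum_erase Finset.univ σ.δ (Finset.mem_univ t), Finset.sdiff_singleton_eq_erase]
      omega
    rw [hδ]
    simp only [cost_bind, cost, eval_tab, FieldProg.eval, FieldOp.eval]
    have h2 := cost_tab_le (ℓ + 1) (fun j => FieldProg.arith .div (σ'.H j d.1 d.2)
      (σ'.H t d.1 d.2) fun r => ret r) 1 fun j => by simp [cost]
    have h3 := cost_tab_le (ℓ + 1) (fun j =>
      if j = t then ret (shiftDown z (σ'.H t))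
      else tab s fun a => subMulProg (σ'.H j d.1 d.2 / σ'.H t d.1 d.2) (σ'.H j a) (σ'.H t a))
      (s * (s * 2)) fun j => by
        split_ifs
        · simp [cost]
        · exact cost_tab_le _ _ _ fun a => cost_subMulProg_le _ _ _
    have h4 := cost_tab_le (ℓ + 1) (fun j => tab (ℓ + 1) fun k =>
      if j = t then mulLinProg z x₀ (σ'.T t k)
      else subMulProg (σ'.H j d.1 d.2 / σ'.H t d.1 d.2) (σ'.T j k) (σ'.T t k))
      ((ℓ + 1) * ((s + 1) * 2)) fun j => cost_tab_le _ _ _ fun k => by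
        split_ifs
        · exact cost_mulLinProg_le _ _ _
        · exact cost_subMulProg_le _ _ _
    rw [add_one_mul (∑ j, σ.δ j)]
    have h5 : (ℓ + 1) * (s * (s * 2)) = 2 * (ℓ + 1) * s ^ 2 := by ring
    have h6 : (ℓ + 1) * ((ℓ + 1) * ((s + 1) * 2)) = 2 * (ℓ + 1) ^ 2 * (s + 1) := by ring
    rw [h5] at h3
    rw [h6] at h4
    omega

end Steps

/-! ### The whole program and the final bound -/

section InterpolatePoint

variable {F : Type*} [Field F] [DecidableEq F] {ℓ s : ℕ}

/-- The loop of the program, for the members of `ds`. -/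
def loopProg {R : Type*} (z x₀ : R) (e : Fin (ℓ + 1) → ℕ) (σ : ProgState R ℓ s)
    (ds : List (Fin s × Fin s)) : FieldProg R (ProgState R ℓ s) :=
  fold (fun σ d => stepProg z x₀ e σ d) σ ds

variable {σ' : ProgState F ℓ s} {x₀ y₀ : F} {bhat : Fin (ℓ + 1) → F[X][Y]}
  {δ e : Fin (ℓ + 1) → ℕ}

lemma eval_loopProg (h : σ'.Represents (initState s x₀ y₀ bhat δ)) (ds : List (Fin s × Fin s)) :
    (loopProg 0 x₀ e σ' ds).eval.Represents (loop s x₀ y₀ bhat δ e ds) := by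
  induction ds using List.reverseRecOn with
  | nil => exact h
  | append_singleton ds d ih =>
    rw [loopProg, eval_fold] at ih ⊢
    rw [List.foldl_append, loop_append]
    exact ih.step x₀ e d

lemma cost_loopProg_le (h : σ'.Represents (initState s x₀ y₀ bhat δ))
    (ds : List (Fin s × Fin s)) :
    (loopProg 0 x₀ e σ' ds).cost + (∑ j, δ j) * (2 * (ℓ + 1) * s ^ 2) ≤
      ds.length * (5 * (ℓ + 1) + 2 * (ℓ + 1) ^ 2 * (s + 1) + 1) +
        (∑ j, (loop s x₀ y₀ bhat δ e ds).δ j) * (2 * (ℓ + 1) * s ^ 2) := by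
  induction ds using List.reverseRecOn with
  | nil => simp [loopProg, fold, cost, loop, initState]
  | append_singleton ds d ih =>
    have h1 := cost_stepProg_le (eval_loopProg (e := e) h ds) 0 x₀ e d
    rw [loopProg] at ih h1 ⊢
    rw [cost_fold_append, loop_append, List.length_append, List.length_singleton,
      add_one_mul ds.length]
    omega

/-- The state of the program before the loop. -/
def initProgState {R : Type*} (z u : R) (H : Fin (ℓ + 1) → Fin s → Fin s → R)
    (δ : Fin (ℓ + 1) → ℕ) : ProgState R ℓ s :=
  ⟨H, fun j k i => if j = k ∧ i.val = 0 then u else z, δ⟩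

lemma initProgState_represents (hy : ∀ j k, ℓ + 1 ≤ k → (bhat j).coeff k = 0)
    (hx : ∀ j k i, s ≤ i → ((bhat j).coeff k).coeff i = 0) :
    (initProgState (s := s) 0 1 (fun j => (hasseProg 0 x₀ y₀ fun (k : Fin (ℓ + 1)) (i : Fin s) =>
      ((bhat j).coeff k).coeff i).eval) δ).Represents (initState s x₀ y₀ bhat δ) where
  H j a c := by
    simp only [initProgState, eval_hasseProg x₀ y₀ (hy j) (hx j)]
    rfl
  T j k i := by
    simp only [initProgState, initState, Matrix.one_apply]
    by_cases hjk : j = k <;> simp [hjk, coeff_one]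
  δ := rfl

variable {c : Fin (ℓ + 1) → Fin (ℓ + 1) → Fin s → F}

lemma eval_interpolatePointProg :
    (interpolatePointProg x₀ y₀ c δ e).eval =
      ((loopProg 0 x₀ e (initProgState 0 1 (fun j => (hasseProg 0 x₀ y₀ (c j)).eval) δ)
          (orders s)).eval.T,
        (loopProg 0 x₀ e (initProgState 0 1 (fun j => (hasseProg 0 x₀ y₀ (c j)).eval) δ)
          (orders s)).eval.δ) := by
  simp only [interpolatePointProg, FieldProg.eval, eval_bind, eval_tab]
  rfl

lemma cost_interpolatePointProg_le :
    (interpolatePointProg x₀ y₀ c δ e).cost ≤ 4 * (ℓ + 1) ^ 2 * s ^ 2 + 2 +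
      (loopProg 0 x₀ e (initProgState 0 1 (fun j => (hasseProg 0 x₀ y₀ (c j)).eval) δ)
        (orders s)).cost := by
  have h := cost_tab_le (ℓ + 1) (fun j => hasseProg 0 x₀ y₀ (c j)) _
    fun j => cost_hasseProg_le _ _ _ _
  have h1 : (ℓ + 1) * (4 * (ℓ + 1) * s ^ 2) = 4 * (ℓ + 1) ^ 2 * s ^ 2 := by ring
  simp only [interpolatePointProg, cost, cost_bind, eval_tab]
  change _ + ((loopProg 0 x₀ e (initProgState 0 1 (fun j => (hasseProg 0 x₀ y₀ (c j)).eval) δ)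
        (orders s)).cost + 0) + 1 + 1 ≤ _
  omega

lemma cost_bound (hℓ : 0 < ℓ) (hs : 0 < s) :
    4 * (ℓ + 1) ^ 2 * s ^ 2 + 2 + s ^ 2 * (5 * (ℓ + 1) + 2 * (ℓ + 1) ^ 2 * (s + 1) + 1) +
      (ℓ + 1) * s * (2 * (ℓ + 1) * s ^ 2) ≤ 100 * ℓ ^ 2 * s ^ 3 := by
  -- Written in `ℓ - 1` and `s - 1`, the difference of the two sides has only nonnegative
  -- coefficients, so `positivity` applies.
  obtain ⟨l, rfl⟩ := Nat.exists_eq_add_of_lt hℓ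
  obtain ⟨r, rfl⟩ := Nat.exists_eq_add_of_lt hs
  simp only [zero_add]
  zify
  rw [← sub_nonneg]
  ring_nf
  positivity

end InterpolatePoint

end KNH

theorem mainTheorem2 :
    ∃ K : ℕ, ∀ (F : Type*) [Field F] [DecidableEq F] (ℓ s w : ℕ) (_ : 0 < ℓ) (_ : 0 < s)
      (_ : 0 < w) (x₀ y₀ : F) (b : Fin (ℓ + 1) → F[X][Y]) (δ e : Fin (ℓ + 1) → ℕ)
      (_ : ∀ j, b j ∈ degreeLE F[X] (ℓ : WithBot ℕ))
      (_ : KNH.IsMinGroebnerBasis w b (Submodule.span F[X] (Set.range b)))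
      (_ : ∀ j, KNH.wdeg w (b j) = (δ j : WithBot ℕ))
      (_ : ∀ j, ∃ i, KNH.IsLeadMon w (b j) (i, e j))
      (bhat : Fin (ℓ + 1) → F[X][Y]) (_ : ∀ j, bhat j = KNH.modX (b j) ((X - C x₀) ^ s))
      (T : Matrix (Fin (ℓ + 1)) (Fin (ℓ + 1)) F[X]) (δ' : Fin (ℓ + 1) → ℕ)
      (_ : KNH.interpolatePoint s x₀ y₀ bhat δ e = (T, δ')),
      -- correctness of the output
      (KNH.IsMinGroebnerBasis w (KNH.matApply T b)
          (Submodule.span F[X] (Set.range b) ⊓ KNH.zeroModule ℓ s x₀ y₀) ∧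
        (∀ j, KNH.wdeg w (KNH.matApply T b j) = (δ' j : WithBot ℕ)) ∧
        (∀ j, ∃ i, KNH.IsLeadMon w (KNH.matApply T b j) (i, e j))) ∧
      -- in each iteration, the degree of the pivot rises by one and no other degree changes
      (∀ (pre : List (Fin s × Fin s)) (d : Fin s × Fin s) (suf : List (Fin s × Fin s)),
        KNH.orders s = pre ++ d :: suf →
        ∀ σ σ' : KNH.LoopState F ℓ s,
          σ = KNH.loop s x₀ y₀ bhat δ e pre → σ' = σ.step x₀ e d →
          ∀ j,
            (σ.pivot e d = some j →
              KNH.wdeg w (KNH.matApply σ'.T b j) = KNH.wdeg w (KNH.matApply σ.T b j) + 1) ∧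
            (σ.pivot e d ≠ some j →
              KNH.wdeg w (KNH.matApply σ'.T b j) = KNH.wdeg w (KNH.matApply σ.T b j))) ∧
      -- the program computes this output within `K * ℓ ^ 2 * s ^ 3` operations
      (∀ P, P = KNH.interpolatePointProg x₀ y₀
            (fun j k (i : Fin s) => ((bhat j).coeff (k : ℕ)).coeff (i : ℕ)) δ e →
        (∀ j k, ∑ i : Fin (s + 1), C (P.eval.1 j k i) * X ^ (i : ℕ) = T j k) ∧
        P.eval.2 = δ' ∧
        P.cost ≤ K * ℓ ^ 2 * s ^ 3) := by
  refine ⟨100, ?_⟩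
  intro F _ _ ℓ s w hℓ hs hw x₀ y₀ b δ e hdeg hb hδ he bhat hbhat T δ' hT
  obtain rfl : bhat = fun j => KNH.modX (b j) ((X - C x₀) ^ s) := funext hbhat
  have hN : Submodule.span F[X] (Set.range b) ≤ degreeLE F[X] (ℓ : WithBot ℕ) :=
    Submodule.span_le.2 (by rintro _ ⟨j, rfl⟩; exact hdeg j)
  have hinv := KNH.loopInvariant_loop (s := s) (x₀ := x₀) (y₀ := y₀) hw hb hδ he
  have hfin := hinv (KNH.orders s) [] (List.append_nil _).symm
  rw [KNH.interpolatePoint, Prod.mk.injEq] at hT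
  obtain ⟨rfl, rfl⟩ := hT
  refine ⟨⟨?_, hfin.wdeg_eq, fun j => (hfin.lead j).imp fun i h => h.1⟩, ?_, ?_⟩
  · rw [← KNH.vanishingModule_orders x₀ y₀ hN]
    exact hfin.isMin
  · rintro pre d suf ho σ σ' rfl rfl j
    exact (hinv pre _ ho).wdeg_step hw ho j
  · rintro P rfl
    have hy : ∀ j k, ℓ + 1 ≤ k → (KNH.modX (b j) ((X - C x₀) ^ s)).coeff k = 0 := by
      intro j k hk
      have h0 : (b j).coeff k = 0 := by
        refine coeff_eq_zero_of_degree_lt ((mem_degreeLE.1 (hdeg j)).trans_lt ?_)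
        exact_mod_cast hk
      rw [KNH.coeff_modX, h0, EuclideanDomain.zero_mod]
    have hx : ∀ j k i, s ≤ i → ((KNH.modX (b j) ((X - C x₀) ^ s)).coeff k).coeff i = 0 := by
      intro j k i hi
      rw [KNH.coeff_modX]
      refine coeff_eq_zero_of_degree_lt (lt_of_lt_of_le
        (EuclideanDomain.mod_lt _ (pow_ne_zero _ (X_sub_C_ne_zero x₀))) ?_)
      rw [degree_pow, degree_X_sub_C, nsmul_one]
      exact_mod_cast hi
    have hrep := KNH.initProgState_represents (x₀ := x₀) (y₀ := y₀) (δ := δ) hy hx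
    have hev := KNH.eval_loopProg (e := e) hrep (KNH.orders s)
    rw [KNH.eval_interpolatePointProg]
    refine ⟨fun j k => ?_, hev.δ, KNH.cost_interpolatePointProg_le.trans ?_⟩
    · simp only [hev.T]
      -- The bound `s` on the degrees of the entries of `T` shows that the arrays of length `s + 1`
      -- lose nothing.
      refine KNH.sum_C_mul_X_pow_eq_of_coeff_eq_zero fun i hi => ?_
      exact coeff_eq_zero_of_natDegree_lt (((hfin.growth_orders hs j).1 k).trans_lt hi)
    · have hc := KNH.cost_loopProg_le (e := e) hrep (KNH.orders s)
      -- The degrees rise by at most `s` each, so at most `(ℓ + 1) * s` pivots are paid for; the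
      -- initial potential cancels in the final comparison.
      have hsum : ∑ j, (KNH.loop s x₀ y₀ (fun j => KNH.modX (b j) ((X - C x₀) ^ s)) δ e
          (KNH.orders s)).δ j ≤ (∑ j, δ j) + (ℓ + 1) * s := by
        refine (Finset.sum_le_sum fun j _ => (hfin.growth_orders hs j).2).trans_eq ?_
        simp [Finset.sum_add_distrib]
      have h1 := Nat.mul_le_mul_right (2 * (ℓ + 1) * s ^ 2) hsum
      have h2 := Nat.mul_le_mul_right (5 * (ℓ + 1) + 2 * (ℓ + 1) ^ 2 * (s + 1) + 1)
        (KNH.length_orders_le s)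
      rw [add_mul] at h1
      linarith [KNH.cost_bound hℓ hs]
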